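/- Let $\overline{T}$ be the group of all orientation preserving homeomorphisms $f$ of $\mathbf{R}$ with $f(x+1)=f(x)+1$ for all $x$ that are piecewise linear, with breakpoints in $\mathbf{Z}[\frac12]$ and finitely many breakpoints modulo $\mathbf{Z}$, and whose linear parts are of the form $x\mapsto 2^n x+d$ with $n\in\mathbf{Z}$, $d\in\mathbf{Z}[\frac12]$ (the lift to $\mathbf{R}$ of Thompson's group $T$ acting on $\mathbf{R}/\mathbf{Z}$). For $\lambda>1$ let $\overline{T}_\lambda$ be the group of the homeomorphisms $x\mapsto \lambda\, g(x/\lambda)$ with $g\in\overline{T}$, and let $G_\lambda=\langle \overline{T},\overline{T}_\lambda\rangle\leq \mathrm{Homeo}^+(\mathbf{R})$. For every irrational $\lambda>1$, the group $G_\lambda$ is finitely generated and simple, and it admits a minimal action by homeomorphisms on the torus $\mathbf{R}^2/\mathbf{Z}^2$ (that is, every orbit is dense). More precisely, there is an action of $G_\lambda$ by homeomorphisms on $\mathbf{R}^2$ that commutes with the translations by $\mathbf{Z}^2$, maps every line of slope $\lambda$ onto itself, restricts on the line through the origin to the original action, i.e. $g\cdot(t/\lambda,t)=(g(t)/\lambda,\,g(t))$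 for $g\in G_\lambda$ and $t\in\mathbf{R}$, and induces on $\mathbf{R}^2/\mathbf{Z}^2$ a minimal action. In particular, there exist finitely generated simple groups of homeomorphisms of the real line that admit a minimal action by homeomorphisms on the torus. -/

import Mathlib

open Topology

/-- The dyadic rationals `ℤ[1/2]`, as real numbers. -/
def IsDyadic (x : ℝ) : Prop :=
  ∃ (a : ℤ) (k : ℕ), x = (a : ℝ) / 2 ^ k

/-- The lift to the real line of Thompson's group `T` acting on the circle `ℝ / ℤ`: the orientation
preserving homeomorphisms `f` of `ℝ` that commute with the translation by `1` and for which there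
is a finite set `B` of dyadic rationals such that, at every point outside `B + ℤ`, the map `f` is
locally of the form `y ↦ 2 ^ n * y + d` with `n` an integer and `d` a dyadic rational.
(Such an `f` is affine with these coefficients on each component of the complement of `B + ℤ`.) -/
def thompsonLift : Set (ℝ ≃ₜ ℝ) :=
  {f | StrictMono f ∧ (∀ x : ℝ, f (x + 1) = f x + 1) ∧
    ∃ B : Finset ℝ, (∀ b ∈ B, IsDyadic b) ∧
      ∀ x : ℝ, (∀ b ∈ B, ∀ m : ℤ, x ≠ b + m) →
        ∃ (n : ℤ) (d : ℝ), IsDyadic d ∧ ∀ᶠ y in 𝓝 x, f y = 2 ^ n * y + d}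

/-- The lift to the real line of the action of Thompson's group `T` on the circle `ℝ / lam ℤ`,
identified with `ℝ / ℤ` by rescaling: the homeomorphisms `x ↦ lam * g (x / lam)` with `g` in
`thompsonLift` (for `lam ≠ 0`). -/
def thompsonLiftScaled (lam : ℝ) : Set (ℝ ≃ₜ ℝ) :=
  {f | ∃ g ∈ thompsonLift, ∀ x : ℝ, f (lam * x) = lam * g x}

/-- The group of homeomorphisms of the real line generated by the two lifts. -/
def GLambda (lam : ℝ) : Subgroup (ℝ ≃ₜ ℝ) :=
  Subgroup.closure (thompsonLift ∪ thompsonLiftScaled lam)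

/-- The two-dimensional torus `ℝ² / ℤ²`. -/
abbrev Torus : Type := UnitAddCircle × UnitAddCircle

/-- The quotient map from the plane to the torus. -/
def torusProj (p : ℝ × ℝ) : Torus := ((p.1 : UnitAddCircle), (p.2 : UnitAddCircle))

/-- An action of a group by homeomorphisms of a space is minimal if every orbit is dense. -/
def IsMinimalAction {G X : Type*} [Group G] [TopologicalSpace X] (ρ : G →* (X ≃ₜ X)) : Prop :=
  ∀ x : X, Dense (Set.range fun g : G => ρ g x)

/-- The line of slope `lam` in the plane with intercept `c`; for fixed `lam`, these lines are the
leaves of the foliation of the plane by lines of slope `lam`. -/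
def slopeLeaf (lam c : ℝ) : Set (ℝ × ℝ) := {p | p.2 = lam * p.1 + c}

/-!
Write `T` for the lift of Thompson's group to the line and `T'` for its rescaled copy, so that
`GLambda lam` is generated by `T` and `T'`.

*The torus.* The `ℤ²`-translates of the line of slope `lam` through the origin are dense in the plane,
so a homeomorphism of the plane that commutes with `ℤ²` and preserves all lines of slope `lam` is
determined by what it does on this line. These homeomorphisms form a group (`leafGroup`), and
restriction to the line is an injective homomorphism whose image contains `T` and `T'`
(`verticalLift`, `horizontalLift`), hence `GLambda lam`. Its inverse is the action on the plane. The
action on the torus is minimal because `T` contains all dyadic translations.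

*Thompson's group.* To a dyadic interval `D` is attached the element `rot D` of `T` that is supported in
`D + ℤ` and acts on dyadic subdivisions of `D`, viewed as binary trees, as a rotation at the root.
Any two subdivisions of `D` into the same number of pieces are related by rotations
(`IsSubdiv.exists_comb`), so an element of `T` supported in `D + ℤ` is a product of rotations inside `D`
(`mem_treeGroup`). Moving a given element into this position with rotations of short intervals shows
that `T` is generated by the `rot D` with `D` short (`eq_top_of_rot_mem`). As `rot D` conjugates
rotations inside `D` to one another, finitely many of them suffice (`exists_finite_closure_eq`), and a
normal subgroup of `T` that contains one of them is everything (`eq_top_of_normal`). Finally the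
pentagon relation `rot D ^ 2 = rot D₀ * rot D * rot D₁`, all of whose factors are conjugate when `D`
lies in the interior of a larger interval, shows that `rot D` is a product of commutators of elements with
small support (`map_rotIn_eq_one`, `rotIn_mem_commutator`).

*Simplicity.* Let `q` be a homomorphism from `GLambda lam` whose kernel contains some `n ≠ 1`. On the
torus, `n` moves a small box off itself; hence elements supported in this box have commuting images
(`exists_boxCommutes`). On the torus the elements of `T` with small support are supported in a
horizontal strip, those of `T'` in a vertical strip, and the commutator of one of each is supported
in a box. This forces `q ⁅a, a'⁆` to commute with `q b` for `a`, `a'` in `T` and `b` in `T'` with small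
supports (`commute_local_commutator`), and then for all `b` in `T'`, because integer translations move
the box along a dense set of positions in the strip (`commute_commutator_scaledEmb`).
With `b` a translation that moves the strip of `a` off itself, `q ⁅a, a'⁆` commutes with the image of
the whole group of elements of `T` supported in this strip (`commute_commutator_local`). By the pentagon relation some `rot D` is in the
kernel, so `q` is trivial on `T` (`stdEmb_trivial`). In particular the translation by `1` is in the
kernel; it moves the vertical strips off themselves, and the same argument shows that `q` is trivial
on `T'` (`scaledEmb_trivial`).
-/

open Filter Set
open scoped commutatorElement

/-! ### Thompson's group and dyadic grids -/

theorem IsDyadic.eventually {b : ℝ} (hb : IsDyadic b) :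
    ∀ᶠ M : ℕ in atTop, ∃ c : ℤ, b = c / 2 ^ M := by
  obtain ⟨a, k, rfl⟩ := hb
  filter_upwards [eventually_ge_atTop k] with M hM
  obtain ⟨d, rfl⟩ := Nat.exists_eq_add_of_le hM
  refine ⟨a * 2 ^ d, ?_⟩
  push_cast
  rw [pow_add]
  field_simp

theorem IsDyadic.add {a b : ℝ} (ha : IsDyadic a) (hb : IsDyadic b) : IsDyadic (a + b) := by
  obtain ⟨M, ⟨c, rfl⟩, ⟨d, rfl⟩⟩ := (ha.eventually.and hb.eventually).exists
  exact ⟨c + d, M, by push_cast; ring⟩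

theorem IsDyadic.neg {a : ℝ} (ha : IsDyadic a) : IsDyadic (-a) := by
  obtain ⟨c, k, rfl⟩ := ha
  exact ⟨-c, k, by push_cast; ring⟩

theorem IsDyadic.sub {a b : ℝ} (ha : IsDyadic a) (hb : IsDyadic b) : IsDyadic (a - b) := by
  rw [sub_eq_add_neg]; exact ha.add hb.neg

theorem isDyadic_int (n : ℤ) : IsDyadic n := ⟨n, 0, by simp⟩

theorem isDyadic_inv_two_pow (m : ℕ) : IsDyadic ((2 ^ m : ℝ)⁻¹) := ⟨1, m, by simp⟩

/-- `f` maps each cell `[i / 2 ^ M, (i + 1) / 2 ^ M]` of the grid of mesh `2 ^ (-M)` affinely onto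
an interval `[j / 2 ^ k, (j + 1) / 2 ^ k]` with `j` an integer and `K ≤ k`. -/
def IsStd (f : ℝ → ℝ) (M K : ℕ) : Prop :=
  ∀ i : ℤ, ∃ k : ℕ, K ≤ k ∧ ∃ j : ℤ, ∀ x ∈ Icc (0 : ℝ) 1, f ((i + x) / 2 ^ M) = (j + x) / 2 ^ k

theorem periodic_add_int {f : ℝ → ℝ} (hf : ∀ x, f (x + 1) = f x + 1) (x : ℝ) (n : ℤ) :
    f (x + n) = f x + n := by
  induction n using Int.induction_on with
  | zero => simp
  | succ i ih => push_cast at *; rw [← add_assoc, hf, ih, add_assoc]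
  | pred i ih =>
    have := hf (x + ((-(i : ℤ) - 1 : ℤ) : ℝ))
    push_cast at *
    rw [show x + (-(i : ℝ) - 1) + 1 = x + -i by ring, ih] at this
    linarith

/-- Two affine maps that agree near a point are equal. -/
theorem affine_unique {x : ℝ} {n n' : ℤ} {d d' : ℝ}
    (h : ∀ᶠ y in 𝓝 x, (2 : ℝ) ^ n * y + d = 2 ^ n' * y + d') : n = n' ∧ d = d' := by
  obtain ⟨ε, hε, hb⟩ := Metric.eventually_nhds_iff.1 h
  have h0 := hb (y := x) (by simpa using hε)
  have h1 := hb (y := x + ε / 2) (by rw [Real.dist_eq, add_sub_cancel_left, abs_of_pos (by linarith)]; linarith)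
  have h2 : ((2 : ℝ) ^ n - 2 ^ n') * (ε / 2) = 0 := by linarith
  have h3 : (2 : ℝ) ^ n = 2 ^ n' := by
    rcases mul_eq_zero.1 h2 with h | h <;> linarith
  have h4 : n = n' := zpow_right_injective₀ (by norm_num) (by norm_num) h3
  subst h4
  exact ⟨rfl, by linarith⟩

/-- A continuous map that is locally affine with slopes powers of two on an open interval is
given by a single affine formula on the closed interval. -/
theorem affine_on_cell {f : ℝ → ℝ} (hf : Continuous f) {a b : ℝ} (hab : a < b)
    (h : ∀ x ∈ Ioo a b, ∃ (n : ℤ) (d : ℝ), IsDyadic d ∧ ∀ᶠ y in 𝓝 x, f y = 2 ^ n * y + d) :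
    ∃ (n : ℤ) (d : ℝ), IsDyadic d ∧ ∀ y ∈ Icc a b, f y = 2 ^ n * y + d := by
  obtain ⟨x0, hx0⟩ : (Ioo a b).Nonempty := nonempty_Ioo.2 hab
  obtain ⟨n, d, hd, hnd⟩ := h x0 hx0
  refine ⟨n, d, hd, ?_⟩
  let U : Set ℝ := {x | ∀ᶠ y in 𝓝 x, f y = 2 ^ n * y + d}
  let V : Set ℝ := {x | ∃ (n' : ℤ) (d' : ℝ), ¬ (n' = n ∧ d' = d) ∧ ∀ᶠ y in 𝓝 x, f y = 2 ^ n' * y + d'}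
  have hU : IsOpen U := isOpen_setOfPred_eventually_nhds
  have hV : IsOpen V := by
    have : V = ⋃ (n' : ℤ) (d' : ℝ) (_ : ¬ (n' = n ∧ d' = d)),
        {x | ∀ᶠ y in 𝓝 x, f y = 2 ^ n' * y + d'} := by ext; simp [V]
    rw [this]
    exact isOpen_iUnion fun _ => isOpen_iUnion fun _ => isOpen_iUnion fun _ =>
      isOpen_setOfPred_eventually_nhds
  have hcov : Ioo a b ⊆ U ∪ V := by
    intro x hx
    obtain ⟨n', d', -, h'⟩ := h x hx
    by_cases hc : n' = n ∧ d' = d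
    · left; obtain ⟨rfl, rfl⟩ := hc; exact h'
    · right; exact ⟨n', d', hc, h'⟩
  have hsub : Ioo a b ⊆ U := by
    by_contra hcon
    obtain ⟨x, hx, hxU⟩ := not_subset.1 hcon
    obtain ⟨z, -, hzU, n', d', hne, hz⟩ := isPreconnected_Ioo U V hU hV hcov ⟨x0, hx0, hnd⟩
      ⟨x, hx, (hcov hx).resolve_left hxU⟩
    apply hne
    apply affine_unique (x := z)
    filter_upwards [hzU, hz] with y h1 h2
    rw [← h1, ← h2]
  have hcl : closure (Ioo a b) ⊆ {y | f y = 2 ^ n * y + d} :=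
    closure_minimal (fun y hy => (hsub hy).self_of_nhds) (isClosed_eq hf (by fun_prop))
  rwa [closure_Ioo hab.ne] at hcl

/-- As the breakpoints are dyadic, an element of Thompson's group is affine on the cells of a grid. -/
theorem thompsonLift.cells {f : ℝ ≃ₜ ℝ} (hf : f ∈ thompsonLift) :
    ∃ M : ℕ, ∀ i : ℤ, ∃ (n : ℤ) (d : ℝ), IsDyadic d ∧
      ∀ y ∈ Icc ((i : ℝ) / 2 ^ M) ((i + 1) / 2 ^ M), f y = 2 ^ n * y + d := by
  obtain ⟨-, -, B, hB, hloc⟩ := hf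
  have : ∀ᶠ M : ℕ in atTop, ∀ b ∈ B, ∃ c : ℤ, b = c / 2 ^ M :=
    (Filter.eventually_all_finset B).2 fun b hb => (hB b hb).eventually
  obtain ⟨M, hM⟩ := this.exists
  refine ⟨M, fun i => ?_⟩
  have h2 : (0 : ℝ) < 2 ^ M := by positivity
  refine affine_on_cell f.continuous (by gcongr; linarith) fun x hx => hloc x fun b hb m hxb => ?_
  obtain ⟨c, rfl⟩ := hM b hb
  have e : x = ((c + m * 2 ^ M : ℤ) : ℝ) / 2 ^ M := by rw [hxb]; push_cast; field_simp
  rw [e, mem_Ioo, div_lt_div_iff_of_pos_right h2, div_lt_div_iff_of_pos_right h2] at hx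
  have h3 : i < c + m * 2 ^ M := by exact_mod_cast hx.1
  have h4 : c + m * 2 ^ M < i + 1 := by exact_mod_cast hx.2
  omega

/-- On all sufficiently fine grids an element of Thompson's group maps cells to standard dyadic
intervals, which moreover are as small as desired. -/
theorem thompsonLift.isStd {f : ℝ ≃ₜ ℝ} (hf : f ∈ thompsonLift) (K : ℕ) :
    ∀ᶠ M : ℕ in atTop, IsStd f M K := by
  obtain ⟨M₀, hM₀⟩ := thompsonLift.cells hf
  have key : ∀ i₀ : ℤ, ∀ᶠ M : ℕ in atTop, ∀ i : ℤ,
      (i₀ : ℝ) / 2 ^ M₀ ≤ i / 2 ^ M → ((i : ℝ) + 1) / 2 ^ M ≤ (i₀ + 1) / 2 ^ M₀ →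
      ∃ k : ℕ, K ≤ k ∧ ∃ j : ℤ, ∀ x ∈ Icc (0 : ℝ) 1, f ((i + x) / 2 ^ M) = (j + x) / 2 ^ k := by
    intro i₀
    obtain ⟨n, d, ⟨a, e, rfl⟩, hnd⟩ := hM₀ i₀
    filter_upwards [eventually_ge_atTop ((max K e) + n.natAbs)] with M hM i h1 h2
    obtain ⟨k, hk⟩ : ∃ k : ℕ, (k : ℤ) = M - n := ⟨(M - n).toNat, by omega⟩
    have hKk : K ≤ k := by omega
    obtain ⟨t, rfl⟩ : ∃ t, k = e + t := Nat.exists_eq_add_of_le (by omega)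
    refine ⟨e + t, hKk, i + a * 2 ^ t, fun x hx => ?_⟩
    rw [hnd]
    · have hn : n = M - ((e + t : ℕ) : ℤ) := by omega
      rw [hn, zpow_sub₀ (by norm_num), zpow_natCast, zpow_natCast, pow_add]
      push_cast
      field_simp
      ring
    · have : (0 : ℝ) < 2 ^ M := by positivity
      exact ⟨h1.trans (by gcongr; linarith [hx.1]), le_trans (by gcongr; exact hx.2) h2⟩
  have key2 : ∀ᶠ M : ℕ in atTop, ∀ i₀ ∈ Finset.Ico (0 : ℤ) (2 ^ M₀), ∀ i : ℤ,
      (i₀ : ℝ) / 2 ^ M₀ ≤ i / 2 ^ M → ((i : ℝ) + 1) / 2 ^ M ≤ (i₀ + 1) / 2 ^ M₀ →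
      ∃ k : ℕ, K ≤ k ∧ ∃ j : ℤ, ∀ x ∈ Icc (0 : ℝ) 1, f ((i + x) / 2 ^ M) = (j + x) / 2 ^ k :=
    (Filter.eventually_all_finset _).2 fun i₀ _ => key i₀
  filter_upwards [key2, eventually_ge_atTop M₀] with M hM hMM i
  obtain ⟨t, rfl⟩ := Nat.exists_eq_add_of_le hMM
  set r := i % 2 ^ (M₀ + t) with hr
  set q := i / 2 ^ (M₀ + t) with hq
  have hi : i = r + q * 2 ^ (M₀ + t) := by rw [hr, hq, mul_comm]; exact (Int.emod_add_mul_ediv _ _).symm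
  have hpos : (0 : ℤ) < 2 ^ (M₀ + t) := by positivity
  have hpt : (0 : ℤ) < 2 ^ t := by positivity
  have hr0 : 0 ≤ r := Int.emod_nonneg _ hpos.ne'
  have hr1 : r < 2 ^ (M₀ + t) := Int.emod_lt_of_pos _ hpos
  have hc0 : r / 2 ^ t * 2 ^ t ≤ r := Int.ediv_mul_le _ hpt.ne'
  have hc1 : r + 1 ≤ (r / 2 ^ t + 1) * 2 ^ t := Int.lt_ediv_add_one_mul_self _ hpt
  obtain ⟨k, hk, j, hj⟩ := hM (r / 2 ^ t) (by
      rw [Finset.mem_Ico]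
      refine ⟨Int.ediv_nonneg hr0 hpt.le, Int.ediv_lt_of_lt_mul hpt ?_⟩
      rwa [← pow_add]) r (by
      rw [div_le_div_iff₀ (by positivity) (by positivity), pow_add]
      have : ((r / 2 ^ t : ℤ) : ℝ) * 2 ^ t ≤ r := by exact_mod_cast hc0
      nlinarith [show (0 : ℝ) < 2 ^ M₀ by positivity]) (by
      rw [div_le_div_iff₀ (by positivity) (by positivity), pow_add]
      have : (r : ℝ) + 1 ≤ ((r / 2 ^ t : ℤ) + 1) * 2 ^ t := by exact_mod_cast hc1
      nlinarith [show (0 : ℝ) < 2 ^ M₀ by positivity])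
  refine ⟨k, hk, j + q * 2 ^ k, fun x hx => ?_⟩
  have e : ((i : ℝ) + x) / 2 ^ (M₀ + t) = (r + x) / 2 ^ (M₀ + t) + q := by
    conv_lhs => rw [hi]
    push_cast
    field_simp
    ring
  rw [e, periodic_add_int hf.2.1, hj x hx]
  push_cast
  field_simp
  ring

theorem floor_cell (x : ℝ) (M : ℕ) : ∃ (i : ℤ) (u : ℝ), 0 ≤ u ∧ u < 1 ∧ x = (i + u) / 2 ^ M := by
  refine ⟨⌊x * 2 ^ M⌋, Int.fract (x * 2 ^ M), Int.fract_nonneg _, Int.fract_lt_one _, ?_⟩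
  rw [Int.floor_add_fract]
  field_simp

/-- Conversely, a periodic increasing homeomorphism that maps the cells of some grid affinely onto
standard intervals belongs to Thompson's group. -/
theorem IsStd.mem {f : ℝ ≃ₜ ℝ} (hm : StrictMono f) (hp : ∀ x, f (x + 1) = f x + 1) {M : ℕ}
    (h : IsStd f M 0) : f ∈ thompsonLift := by
  refine ⟨hm, hp, (Finset.range (2 ^ M)).image fun i : ℕ => (i : ℝ) / 2 ^ M, ?_, ?_⟩
  · intro b hb
    obtain ⟨i, -, rfl⟩ := Finset.mem_image.1 hb
    exact ⟨i, M, by simp⟩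
  · intro x hx
    obtain ⟨i, u, hu0, hu1, rfl⟩ := floor_cell x M
    have hu : 0 < u := by
      rcases hu0.lt_or_eq with h | rfl
      · exact h
      exfalso
      have hpos : (0 : ℤ) < 2 ^ M := by positivity
      obtain ⟨r, hr⟩ := Int.eq_ofNat_of_zero_le (Int.emod_nonneg i hpos.ne')
      have hr1 := Int.emod_lt_of_pos i hpos
      refine hx (r / 2 ^ M) (Finset.mem_image.2 ⟨r, ?_, rfl⟩) (i / 2 ^ M) ?_
      · rw [Finset.mem_range]; rw [hr] at hr1; exact_mod_cast hr1
      · have := Int.emod_add_mul_ediv i (2 ^ M)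
        rw [hr] at this
        have h' : (i : ℝ) = r + 2 ^ M * ((i / 2 ^ M : ℤ) : ℝ) := by exact_mod_cast this.symm
        conv_lhs => rw [h']
        field_simp
        ring
    obtain ⟨k, -, j, hj⟩ := h i
    refine ⟨M - k, (j - i) / 2 ^ k, ⟨j - i, k, by push_cast; ring⟩, ?_⟩
    have h2 : (0 : ℝ) < 2 ^ M := by positivity
    have : Ioo ((i : ℝ) / 2 ^ M) ((i + 1) / 2 ^ M) ∈ 𝓝 (((i : ℝ) + u) / 2 ^ M) :=
      Ioo_mem_nhds (by gcongr; linarith) (by gcongr)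
    filter_upwards [this] with y hy
    have h0 := (div_lt_iff₀ h2).1 hy.1
    have h1 := (lt_div_iff₀ h2).1 hy.2
    have := hj (y * 2 ^ M - i) ⟨by linarith, by linarith⟩
    rw [show ((i : ℝ) + (y * 2 ^ M - i)) / 2 ^ M = y by field_simp; ring] at this
    rw [this, zpow_sub₀ (by norm_num), zpow_natCast, zpow_natCast]
    field_simp
    ring

/-- By periodicity, only finitely many sizes of images of cells occur. -/
theorem IsStd.exists_bound {f : ℝ → ℝ} (hp : ∀ x, f (x + 1) = f x + 1) {M K : ℕ} (h : IsStd f M K) :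
    ∃ L : ℕ, ∀ i : ℤ, ∃ k : ℕ, k ≤ L ∧ ∃ j : ℤ, ∀ x ∈ Icc (0 : ℝ) 1,
      f ((i + x) / 2 ^ M) = (j + x) / 2 ^ k := by
  choose k hk j hj using h
  have hpos : (0 : ℤ) < 2 ^ M := by positivity
  refine ⟨(Finset.Ico (0 : ℤ) (2 ^ M)).sup k, fun i => ⟨k (i % 2 ^ M), ?_, j (i % 2 ^ M) +
    (i / 2 ^ M) * 2 ^ k (i % 2 ^ M), fun x hx => ?_⟩⟩
  · exact Finset.le_sup (f := k) (Finset.mem_Ico.2 ⟨Int.emod_nonneg _ hpos.ne',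
      Int.emod_lt_of_pos _ hpos⟩)
  · have h' : (i : ℝ) = (i % 2 ^ M : ℤ) + 2 ^ M * ((i / 2 ^ M : ℤ) : ℝ) := by
      exact_mod_cast (Int.emod_add_mul_ediv i (2 ^ M)).symm
    have e : ((i : ℝ) + x) / 2 ^ M = ((i % 2 ^ M : ℤ) + x) / 2 ^ M + (i / 2 ^ M : ℤ) := by
      conv_lhs => rw [h']
      field_simp
      ring
    rw [e, periodic_add_int hp, hj _ x hx]
    push_cast
    field_simp
    ring

theorem thompsonLift.mul_mem {f g : ℝ ≃ₜ ℝ} (hf : f ∈ thompsonLift) (hg : g ∈ thompsonLift) :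
    f * g ∈ thompsonLift := by
  obtain ⟨K, hK⟩ := eventually_atTop.1 (thompsonLift.isStd hf 0)
  obtain ⟨M, hM⟩ := (thompsonLift.isStd hg K).exists
  refine IsStd.mem (M := M) (hf.1.comp hg.1) (fun x => ?_) fun i => ?_
  · simp [hf.2.1, hg.2.1]
  · obtain ⟨k, hk, j, hj⟩ := hM i
    obtain ⟨k', -, j', hj'⟩ := hK k hk j
    exact ⟨k', Nat.zero_le _, j', fun x hx => by simp [hj x hx, hj' x hx]⟩

theorem thompsonLift.inv_mem {f : ℝ ≃ₜ ℝ} (hf : f ∈ thompsonLift) : f⁻¹ ∈ thompsonLift := by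
  obtain ⟨M, hM⟩ := (thompsonLift.isStd hf 0).exists
  obtain ⟨L, hL⟩ := hM.exists_bound hf.2.1
  have hl : ∀ x, f⁻¹ (f x) = x := f.symm_apply_apply
  have hr : ∀ x, f (f⁻¹ x) = x := f.apply_symm_apply
  refine IsStd.mem (M := L) (fun x y hxy => ?_) (fun x => ?_) fun c => ?_
  · rwa [← hf.1.lt_iff_lt, hr, hr]
  · apply f.injective
    rw [hr, hf.2.1, hr]
  · obtain ⟨i, u, hu0, hu1, hu⟩ := floor_cell (f⁻¹ ((c : ℝ) / 2 ^ L)) M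
    obtain ⟨k, hk, j, hj⟩ := hL i
    obtain ⟨t, rfl⟩ := Nat.exists_eq_add_of_le hk
    have h1 : (c : ℝ) / 2 ^ (k + t) = (j + u) / 2 ^ k := by
      rw [← hj u ⟨hu0, hu1.le⟩, ← hu, hr]
    have hpt : (0 : ℝ) < 2 ^ t := by positivity
    have h2 : (c : ℝ) = (j + u) * 2 ^ t := by
      rw [pow_add] at h1; field_simp at h1; linarith
    have h3 : j * 2 ^ t ≤ c := by
      have : (j : ℝ) * 2 ^ t ≤ c := by rw [h2]; gcongr; linarith
      exact_mod_cast this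
    have h4 : c + 1 ≤ (j + 1) * 2 ^ t := by
      have : (c : ℝ) < (j + 1) * 2 ^ t := by rw [h2]; gcongr
      have h5 : c < (j + 1) * 2 ^ t := by exact_mod_cast this
      omega
    have h3' : (j : ℝ) * 2 ^ t ≤ c := by exact_mod_cast h3
    have h4' : (c : ℝ) + 1 ≤ (j + 1) * 2 ^ t := by exact_mod_cast h4
    refine ⟨M + t, Nat.zero_le _, i * 2 ^ t + c - j * 2 ^ t, fun x hx => ?_⟩
    apply f.injective
    rw [hr]
    have := hj ((c + x) / 2 ^ t - j) ⟨by
      rw [sub_nonneg, le_div_iff₀ hpt]; linarith [hx.1], by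
      rw [sub_le_iff_le_add, div_le_iff₀ hpt]; linarith [hx.2]⟩
    convert this.symm using 1
    · rw [pow_add]; field_simp; ring
    · congr 1; push_cast; rw [pow_add]; field_simp; ring

theorem thompsonLift.one_mem : (1 : ℝ ≃ₜ ℝ) ∈ thompsonLift :=
  ⟨strictMono_id, fun _ => rfl, ∅, by simp, fun x _ => ⟨0, 0, ⟨0, 0, by simp⟩, by simp⟩⟩

/-- The lift of Thompson's group `T`, as a subgroup. -/
def thompsonGroup : Subgroup (ℝ ≃ₜ ℝ) where
  carrier := thompsonLift
  mul_mem' := thompsonLift.mul_mem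
  one_mem' := thompsonLift.one_mem
  inv_mem' := thompsonLift.inv_mem

theorem thompsonLift.isDyadic_zero {f : ℝ ≃ₜ ℝ} (hf : f ∈ thompsonLift) : IsDyadic (f 0) := by
  obtain ⟨M, hM⟩ := (thompsonLift.isStd hf 0).exists
  obtain ⟨k, -, j, hj⟩ := hM 0
  exact ⟨j, k, by simpa using hj 0 (by simp)⟩

/-! ### The basic elements: tree rotations of dyadic intervals -/

/-- An interval `[left, left + 2 ^ (-level)]` of the line, representing an arc of the circle `ℝ / ℤ`.
The left endpoint is an arbitrary real number; that it is dyadic is assumed where needed. -/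
structure DyArc where
  left : ℝ
  level : ℕ

namespace DyArc

/-- The length of the interval. -/
noncomputable def len (D : DyArc) : ℝ := (2 ^ D.level)⁻¹

/-- The left half (`b = false`) or the right half (`b = true`) of an interval. -/
noncomputable def child (D : DyArc) (b : Bool) : DyArc :=
  ⟨if b then D.left + D.len / 2 else D.left, D.level + 1⟩

/-- The interval reached from `D` by successively passing to halves, as listed in the word. -/
noncomputable def sub : List Bool → DyArc → DyArc
  | [], D => D
  | b :: w, D => sub w (D.child b)

variable (D : DyArc)

theorem len_pos : 0 < D.len := by unfold len; positivity

theorem len_le_one : D.len ≤ 1 := inv_le_one_of_one_le₀ (one_le_pow₀ (by norm_num))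

theorem len_le_half (h : 1 ≤ D.level) : D.len ≤ 1 / 2 := by
  unfold len
  obtain ⟨n, hn⟩ := Nat.exists_eq_add_of_le h
  rw [hn, pow_add, mul_inv]
  have : ((2 : ℝ) ^ n)⁻¹ ≤ 1 := inv_le_one_of_one_le₀ (one_le_pow₀ (by norm_num))
  linarith

@[simp] theorem child_level (b : Bool) : (D.child b).level = D.level + 1 := rfl
@[simp] theorem child_left_false : (D.child false).left = D.left := rfl
@[simp] theorem child_left_true : (D.child true).left = D.left + D.len / 2 := rfl
@[simp] theorem child_len (b : Bool) : (D.child b).len = D.len / 2 := by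
  simp [len, pow_succ]; ring

@[simp] theorem sub_nil : sub [] D = D := rfl
@[simp] theorem sub_cons (b : Bool) (w : List Bool) : sub (b :: w) D = sub w (D.child b) := rfl

theorem sub_append (w w' : List Bool) : sub (w ++ w') D = sub w' (sub w D) := by
  induction w generalizing D with
  | nil => rfl
  | cons b w ih => simp [ih]

theorem level_le_sub (w : List Bool) : D.level ≤ (sub w D).level := by
  induction w generalizing D with
  | nil => exact le_rfl
  | cons b w ih => exact (Nat.le_succ _).trans (ih (D.child b))

theorem isDyadic_len : IsDyadic D.len := isDyadic_inv_two_pow _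

theorem isDyadic_sub {D : DyArc} (hD : IsDyadic D.left) (w : List Bool) :
    IsDyadic (sub w D).left := by
  induction w generalizing D with
  | nil => exact hD
  | cons b w ih =>
    refine ih (D := D.child b) ?_
    cases b
    · exact hD
    · rw [child_left_true, ← child_len D true]; exact hD.add (isDyadic_len _)

theorem left_le_sub (w : List Bool) : D.left ≤ (sub w D).left := by
  induction w generalizing D with
  | nil => exact le_rfl
  | cons b w ih =>
    refine le_trans ?_ (ih (D.child b))
    cases b <;> simp
    linarith [D.len_pos]

theorem right_sub_le (w : List Bool) : (sub w D).left + (sub w D).len ≤ D.left + D.len := by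
  induction w generalizing D with
  | nil => exact le_rfl
  | cons b w ih =>
    refine (ih (D.child b)).trans ?_
    cases b <;> simp <;> linarith [D.len_pos]

end DyArc

/-- The piecewise linear bijection of the line with slopes `1/2`, `1`, `2` on `[0, s/2]`,
`[s/2, 3s/4]`, `[3s/4, s]` and equal to the identity off `[0, s]`. -/
noncomputable def caret (s v : ℝ) : ℝ := min v (max (v / 2) (max (v - s / 4) (2 * v - s)))

/-- The inverse of `caret s`. -/
noncomputable def caretInv (s v : ℝ) : ℝ := max v (min (2 * v) (min (v + s / 4) ((v + s) / 2)))

theorem caret_strictMono (s : ℝ) : StrictMono (caret s) := by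
  intro v w h
  unfold caret
  refine min_lt_min h (max_lt_max (by linarith) (max_lt_max (by linarith) (by linarith)))

theorem caret_low {s v : ℝ} (h0 : 0 ≤ v) (h1 : v ≤ s / 2) : caret s v = v / 2 := by
  unfold caret
  rw [max_eq_left (max_le (by linarith) (by linarith)), min_eq_right (by linarith)]

theorem caret_mid {s v : ℝ} (h0 : s / 2 ≤ v) (h1 : v ≤ 3 * s / 4) : caret s v = v - s / 4 := by
  unfold caret
  rw [max_eq_left (a := v - s / 4) (by linarith), max_eq_right (by linarith),
    min_eq_right (by linarith)]

theorem caret_high {s v : ℝ} (h0 : 3 * s / 4 ≤ v) (h1 : v ≤ s) : caret s v = 2 * v - s := by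
  unfold caret
  rw [max_eq_right (a := v - s / 4) (by linarith), max_eq_right (by linarith),
    min_eq_right (by linarith)]

theorem caret_out {s v : ℝ} (h0 : s ≤ v) : caret s v = v := by
  unfold caret
  rw [min_eq_left]
  exact le_max_of_le_right (le_max_of_le_right (by linarith))

theorem caret_caretInv {s v : ℝ} (hs : 0 ≤ s) (hv : 0 ≤ v) : caret s (caretInv s v) = v := by
  unfold caretInv
  rcases le_total v (s / 4) with h | h
  · rw [min_eq_left (b := min _ _) (le_min (by linarith) (by linarith)), max_eq_right (by linarith),
      caret_low (by linarith) (by linarith)]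
    ring
  rcases le_total v (s / 2) with h' | h'
  · rw [min_eq_left (a := v + s / 4) (by linarith), min_eq_right (by linarith),
      max_eq_right (by linarith), caret_mid (by linarith) (by linarith)]
    ring
  rcases le_total v s with h'' | h''
  · rw [min_eq_right (a := v + s / 4) (by linarith), min_eq_right (by linarith),
      max_eq_right (by linarith), caret_high (by linarith) (by linarith)]
    ring
  · rw [max_eq_left, caret_out h'']
    exact (min_le_right _ _).trans ((min_le_right _ _).trans (by linarith))

theorem caret_mul {s u : ℝ} (hs : 0 ≤ s) : caret s (s * u) = s * caret 1 u := by
  unfold caret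
  rw [mul_min_of_nonneg _ _ hs, mul_max_of_nonneg _ _ hs, mul_max_of_nonneg _ _ hs]
  ring_nf

theorem caret_mem {s v : ℝ} (hs : 0 ≤ s) (hs1 : s ≤ 1) (h0 : 0 ≤ v) (h1 : v < 1) :
    0 ≤ caret s v ∧ caret s v < 1 := by
  constructor
  · rw [← show caret s 0 = 0 by rw [caret_low le_rfl (by linarith)]; simp]
    exact (caret_strictMono s).monotone h0
  · rw [← show caret s 1 = 1 from caret_out hs1]
    exact caret_strictMono s h1

theorem caretInv_mem {s v : ℝ} (hs : 0 ≤ s) (hs1 : s ≤ 1) (h0 : 0 ≤ v) (h1 : v < 1) :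
    0 ≤ caretInv s v ∧ caretInv s v < 1 := by
  refine ⟨h0.trans (le_max_left _ _), ?_⟩
  rw [← (caret_strictMono s).lt_iff_lt, caret_caretInv hs h0, caret_out hs1]
  exact h1

/-- The periodic extension of a function on the unit interval, based at `a`. -/
noncomputable def perExt (h : ℝ → ℝ) (a x : ℝ) : ℝ := a + ⌊x - a⌋ + h (Int.fract (x - a))

theorem perExt_apply (h : ℝ → ℝ) (a : ℝ) {v : ℝ} (h0 : 0 ≤ v) (h1 : v < 1) (k : ℤ) :
    perExt h a (a + k + v) = a + k + h v := by
  unfold perExt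
  rw [show a + k + v - a = (k : ℝ) + v by ring, Int.floor_intCast_add, Int.fract_intCast_add,
    Int.floor_eq_zero_iff.2 ⟨h0, h1⟩, Int.fract_eq_self.2 ⟨h0, h1⟩]
  simp

theorem exists_floor_add (a x : ℝ) : ∃ (k : ℤ) (v : ℝ), 0 ≤ v ∧ v < 1 ∧ x = a + k + v :=
  ⟨⌊x - a⌋, Int.fract (x - a), Int.fract_nonneg _, Int.fract_lt_one _, by
    rw [add_assoc, Int.floor_add_fract]; ring⟩

theorem perExt_strictMono {h : ℝ → ℝ} (hm : StrictMono h)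
    (hI : ∀ v, 0 ≤ v → v < 1 → 0 ≤ h v ∧ h v < 1) (a : ℝ) : StrictMono (perExt h a) := by
  intro x y hxy
  obtain ⟨k, v, hv0, hv1, rfl⟩ := exists_floor_add a x
  obtain ⟨l, w, hw0, hw1, rfl⟩ := exists_floor_add a y
  rw [perExt_apply h a hv0 hv1, perExt_apply h a hw0 hw1]
  rcases lt_trichotomy k l with hkl | rfl | hkl
  · have : (k : ℝ) + 1 ≤ l := by exact_mod_cast hkl
    linarith [(hI v hv0 hv1).2, (hI w hw0 hw1).1]
  · have := hm (show v < w by linarith)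
    linarith
  · have : (l : ℝ) + 1 ≤ k := by exact_mod_cast hkl
    linarith

/-- The basic element of Thompson's group attached to an interval `D` of length `s`: on `D` it maps
the first half, the third quarter and the fourth quarter affinely onto the first quarter, the
second quarter and the second half; it is periodic and fixes the points outside `D + ℤ`. Acting on
subdivisions of `D`, this is the rotation of a binary tree at its root. -/
noncomputable def rot (D : DyArc) : ℝ ≃ₜ ℝ :=
  (StrictMono.orderIsoOfRightInverse (perExt (caret D.len) D.left)
    (perExt_strictMono (caret_strictMono _)
      (fun _ => caret_mem D.len_pos.le D.len_le_one) _)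
    (perExt (caretInv D.len) D.left)
    (fun x => by
      obtain ⟨k, v, hv0, hv1, rfl⟩ := exists_floor_add D.left x
      have := caretInv_mem D.len_pos.le D.len_le_one hv0 hv1
      rw [perExt_apply _ _ hv0 hv1, perExt_apply _ _ this.1 this.2,
        caret_caretInv D.len_pos.le hv0])).toHomeomorph

theorem rot_apply (D : DyArc) {v : ℝ} (h0 : 0 ≤ v) (h1 : v < 1) (k : ℤ) :
    rot D (D.left + k + v) = D.left + k + caret D.len v :=
  perExt_apply _ _ h0 h1 k

theorem rot_strictMono (D : DyArc) : StrictMono (rot D) :=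
  perExt_strictMono (caret_strictMono _) (fun _ => caret_mem D.len_pos.le D.len_le_one) _

theorem rot_add_one (D : DyArc) (x : ℝ) : rot D (x + 1) = rot D x + 1 := by
  obtain ⟨k, v, hv0, hv1, rfl⟩ := exists_floor_add D.left x
  rw [rot_apply D hv0 hv1, show D.left + k + v + 1 = D.left + (k + 1 : ℤ) + v by push_cast; ring,
    rot_apply D hv0 hv1]
  push_cast
  ring

theorem rot_add_int (D : DyArc) (x : ℝ) (k : ℤ) : rot D (x + k) = rot D x + k :=
  periodic_add_int (rot_add_one D) x k

theorem rot_apply_zero (D : DyArc) {x : ℝ} (h0 : D.left ≤ x) (h1 : x ≤ D.left + 1) :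
    rot D x = D.left + caret D.len (x - D.left) := by
  rcases h1.lt_or_eq with h | rfl
  · have := rot_apply D (v := x - D.left) (by linarith) (by linarith) 0
    simpa using this
  · rw [rot_add_one, add_sub_cancel_left, caret_out D.len_le_one]
    have := rot_apply D (v := 0) le_rfl (by norm_num) 0
    rw [caret_low le_rfl (by linarith [D.len_pos])] at this
    simp at this
    rw [this]

theorem rot_low (D : DyArc) {x : ℝ} (h0 : D.left ≤ x) (h1 : x ≤ D.left + D.len / 2) :
    rot D x = (D.left + x) / 2 := by
  rw [rot_apply_zero D h0 (by linarith [D.len_le_one]), caret_low (by linarith) (by linarith)]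
  ring

theorem rot_mid (D : DyArc) {x : ℝ} (h0 : D.left + D.len / 2 ≤ x)
    (h1 : x ≤ D.left + 3 * D.len / 4) : rot D x = x - D.len / 4 := by
  rw [rot_apply_zero D (by linarith [D.len_pos]) (by linarith [D.len_pos, D.len_le_one]),
    caret_mid (by linarith) (by linarith)]
  ring

theorem rot_high (D : DyArc) {x : ℝ} (h0 : D.left + 3 * D.len / 4 ≤ x)
    (h1 : x ≤ D.left + D.len) : rot D x = 2 * x - D.left - D.len := by
  rw [rot_apply_zero D (by linarith [D.len_pos]) (by linarith [D.len_le_one]),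
    caret_high (by linarith) (by linarith)]
  ring

theorem rot_out (D : DyArc) {x : ℝ} (k : ℤ) (h0 : D.left + D.len ≤ x + k)
    (h1 : x + k ≤ D.left + 1) : rot D x = x := by
  have := rot_apply_zero D (x := x + k) (by linarith [D.len_pos]) h1
  rw [caret_out (by linarith), rot_add_int] at this
  linarith

/-- Outside the interior of `D + ℤ` the element `rot D` is the identity. -/
theorem rot_out' (D : DyArc) {x : ℝ} (h : ∀ k : ℤ, ¬ (D.left < x + k ∧ x + k < D.left + D.len)) :
    rot D x = x := by
  obtain ⟨k, v, hv0, hv1, rfl⟩ := exists_floor_add D.left x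
  have := h (-k)
  push_cast at this
  rcases hv0.lt_or_eq with h0 | rfl
  · refine rot_out D (-k) ?_ ?_ <;> push_cast
    · by_contra hc
      exact this ⟨by linarith, by linarith⟩
    · linarith
  · refine rot_out D (1 - k) ?_ ?_ <;> push_cast <;> linarith [D.len_le_one]

theorem rot_mem {D : DyArc} (hD : IsDyadic D.left) : rot D ∈ thompsonLift := by
  obtain ⟨M', ⟨c', hc'⟩, hM'⟩ := (hD.eventually.and (eventually_ge_atTop (D.level + 2))).exists
  -- the grid is fine enough for the left endpoint to have an even numerator, so that the images
  -- of cells under the branch of slope two are standard intervals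
  obtain ⟨c, hcc⟩ : ∃ c : ℤ, c = 2 * c' := ⟨_, rfl⟩
  obtain ⟨M, hMM⟩ : ∃ M : ℕ, M = M' + 1 := ⟨_, rfl⟩
  have hM : D.level + 2 ≤ M := by omega
  have hc : D.left = (c : ℝ) / 2 ^ M := by
    rw [hc', hcc, hMM, pow_succ]; push_cast; field_simp
  obtain ⟨t, ht⟩ := Nat.exists_eq_add_of_le hM
  refine IsStd.mem (M := M) (rot_strictMono D) (rot_add_one D) fun i => ?_
  -- `N` is the number of grid cells in a quarter of `D`
  obtain ⟨N, hN⟩ : ∃ N : ℤ, N = 2 ^ t := ⟨_, rfl⟩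
  have hlen : D.len = 4 * N / 2 ^ M := by
    rw [hN, ht, DyArc.len, pow_add, pow_add]; push_cast; field_simp; norm_num
  have hN0 : 0 < N := by rw [hN]; positivity
  have hP0 : (0 : ℤ) < 2 ^ M := by positivity
  have hP : (0 : ℝ) < 2 ^ M := by positivity
  obtain ⟨q, r, hr0, hr1, hi⟩ : ∃ q r : ℤ, 0 ≤ r ∧ r < 2 ^ M ∧ i = c + r + q * 2 ^ M :=
    ⟨(i - c) / 2 ^ M, (i - c) % 2 ^ M, Int.emod_nonneg _ hP0.ne', Int.emod_lt_of_pos _ hP0, by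
      have := Int.emod_add_mul_ediv (i - c) (2 ^ M); linarith⟩
  have hx : ∀ x : ℝ, ((i : ℝ) + x) / 2 ^ M = (c + r + x) / 2 ^ M + q := by
    intro x; rw [hi]; push_cast; field_simp; ring
  have hr0' : (0 : ℝ) ≤ r := by exact_mod_cast hr0
  simp only [hx, rot_add_int]
  have cases4 : r + 1 ≤ 2 * N ∨ (2 * N ≤ r ∧ r + 1 ≤ 3 * N) ∨ (3 * N ≤ r ∧ r + 1 ≤ 4 * N) ∨
    4 * N ≤ r := by omega
  rcases cases4 with h | ⟨h, h'⟩ | ⟨h, h'⟩ | h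
  · have h2 : (r : ℝ) + 1 ≤ 2 * N := by exact_mod_cast h
    refine ⟨M + 1, Nat.zero_le _, 2 * c + r + q * 2 ^ (M + 1), fun x hx => ?_⟩
    rw [rot_low]
    · rw [hc]; push_cast; rw [pow_succ]; field_simp; ring
    · rw [hc]; gcongr; linarith [hx.1]
    · rw [hc, hlen, ← sub_nonneg]
      rw [show (c : ℝ) / 2 ^ M + 4 * N / 2 ^ M / 2 - (c + r + x) / 2 ^ M =
        (2 * N - r - x) / 2 ^ M by ring]
      exact div_nonneg (by linarith [hx.2]) hP.le
  · have h2 : 2 * (N : ℝ) ≤ r := by exact_mod_cast h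
    have h3 : (r : ℝ) + 1 ≤ 3 * N := by exact_mod_cast h'
    refine ⟨M, Nat.zero_le _, c + r - N + q * 2 ^ M, fun x hx => ?_⟩
    rw [rot_mid]
    · rw [hlen]; push_cast; field_simp; ring
    · rw [hc, hlen, ← sub_nonneg]
      rw [show (c + r + x) / 2 ^ M - ((c : ℝ) / 2 ^ M + 4 * N / 2 ^ M / 2) =
        (r + x - 2 * N) / 2 ^ M by ring]
      exact div_nonneg (by linarith [hx.1]) hP.le
    · rw [hc, hlen, ← sub_nonneg]
      rw [show (c : ℝ) / 2 ^ M + 3 * (4 * N / 2 ^ M) / 4 - (c + r + x) / 2 ^ M =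
        (3 * N - r - x) / 2 ^ M by ring]
      exact div_nonneg (by linarith [hx.2]) hP.le
  · have h2 : 3 * (N : ℝ) ≤ r := by exact_mod_cast h
    have h3 : (r : ℝ) + 1 ≤ 4 * N := by exact_mod_cast h'
    refine ⟨M', Nat.zero_le _, c' + r - 2 * N + q * 2 ^ M', fun x hx => ?_⟩
    rw [rot_high]
    · rw [hlen, hc, hcc, hMM, pow_succ]; push_cast; field_simp; ring
    · rw [hc, hlen, ← sub_nonneg]
      rw [show (c + r + x) / 2 ^ M - ((c : ℝ) / 2 ^ M + 3 * (4 * N / 2 ^ M) / 4) =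
        (r + x - 3 * N) / 2 ^ M by ring]
      exact div_nonneg (by linarith [hx.1]) hP.le
    · rw [hc, hlen, ← sub_nonneg]
      rw [show (c : ℝ) / 2 ^ M + 4 * N / 2 ^ M - (c + r + x) / 2 ^ M =
        (4 * N - r - x) / 2 ^ M by ring]
      exact div_nonneg (by linarith [hx.2]) hP.le
  · have h2 : 4 * (N : ℝ) ≤ r := by exact_mod_cast h
    have h3 : (r : ℝ) + 1 ≤ 2 ^ M := by exact_mod_cast hr1
    refine ⟨M, Nat.zero_le _, c + r + q * 2 ^ M, fun x hx => ?_⟩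
    rw [rot_out D 0]
    · push_cast; field_simp; ring
    · rw [hc, hlen, ← sub_nonneg]
      rw [show (c + r + x) / 2 ^ M + ((0 : ℤ) : ℝ) - ((c : ℝ) / 2 ^ M + 4 * N / 2 ^ M) =
        (r + x - 4 * N) / 2 ^ M by push_cast; ring]
      exact div_nonneg (by linarith [hx.1]) hP.le
    · rw [hc, ← sub_nonneg]
      rw [show (c : ℝ) / 2 ^ M + 1 - ((c + r + x) / 2 ^ M + ((0 : ℤ) : ℝ)) =
        (2 ^ M - r - x) / 2 ^ M by push_cast; field_simp; ring]
      exact div_nonneg (by linarith [hx.2]) hP.le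

/-- `g` maps the interval `D` affinely onto the interval `E`. -/
def AffOn (g : ℝ → ℝ) (D E : DyArc) : Prop :=
  ∀ u ∈ Icc (0 : ℝ) 1, g (D.left + D.len * u) = E.left + E.len * u

theorem AffOn.child {g : ℝ → ℝ} {D E : DyArc} (h : AffOn g D E) (b : Bool) :
    AffOn g (D.child b) (E.child b) := by
  intro u hu
  cases b
  · have := h (u / 2) ⟨by linarith [hu.1], by linarith [hu.2]⟩
    simp only [DyArc.child_left_false, DyArc.child_len]
    rw [show D.left + D.len / 2 * u = D.left + D.len * (u / 2) by ring, this]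
    ring
  · have := h ((1 + u) / 2) ⟨by linarith [hu.1], by linarith [hu.2]⟩
    simp only [DyArc.child_left_true, DyArc.child_len]
    rw [show D.left + D.len / 2 + D.len / 2 * u = D.left + D.len * ((1 + u) / 2) by ring, this]
    ring

theorem AffOn.sub {g : ℝ → ℝ} {D E : DyArc} (h : AffOn g D E) (w : List Bool) :
    AffOn g (D.sub w) (E.sub w) := by
  induction w generalizing D E with
  | nil => exact h
  | cons b w ih => exact ih (h.child b)

theorem homeo_ext_of_periodic {f g : ℝ ≃ₜ ℝ} (hf : ∀ x, f (x + 1) = f x + 1)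
    (hg : ∀ x, g (x + 1) = g x + 1) (a : ℝ)
    (h : ∀ x, a ≤ x → x ≤ a + 1 → f x = g x) : f = g := by
  ext x
  obtain ⟨k, v, hv0, hv1, rfl⟩ := exists_floor_add a x
  rw [show a + k + v = (a + v) + k by ring, periodic_add_int hf, periodic_add_int hg,
    h _ (by linarith) (by linarith)]

/-- A periodic homeomorphism that maps `D` affinely onto `E` conjugates `rot D` to `rot E`. -/
theorem AffOn.conj {g : ℝ ≃ₜ ℝ} (hg : StrictMono g) (hp : ∀ x, g (x + 1) = g x + 1) {D E : DyArc}
    (h : AffOn g D E) : g * rot D = rot E * g := by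
  refine homeo_ext_of_periodic (a := D.left) (fun x => ?_) (fun x => ?_) fun x h0 h1 => ?_
  · simp [hp, rot_add_one]
  · simp [hp, rot_add_one]
  have hl : g D.left = E.left := by simpa using h 0 (by simp)
  have hr : g (D.left + D.len) = E.left + E.len := by simpa using h 1 (by simp)
  have hl1 : g (D.left + 1) = E.left + 1 := by rw [hp, hl]
  rw [Homeomorph.mul_apply, Homeomorph.mul_apply]
  rcases le_total x (D.left + D.len) with hx | hx
  · obtain ⟨u, rfl⟩ : ∃ u, x = D.left + D.len * u :=
      ⟨(x - D.left) / D.len, by field_simp [D.len_pos.ne']; ring⟩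
    have hu0 : 0 ≤ u := by
      by_contra hc; nlinarith [D.len_pos]
    have hu1 : u ≤ 1 := by
      by_contra hc; nlinarith [D.len_pos]
    have hc0 : 0 ≤ caret 1 u := by
      rw [← show caret 1 0 = 0 by rw [caret_low le_rfl (by norm_num)]; simp]
      exact (caret_strictMono 1).monotone hu0
    have hc1 : caret 1 u ≤ 1 :=
      ((caret_strictMono 1).monotone hu1).trans_eq (caret_out le_rfl)
    rw [rot_apply_zero D h0 h1, h u ⟨hu0, hu1⟩, rot_apply_zero E
      (by nlinarith [E.len_pos]) (by nlinarith [E.len_pos, E.len_le_one]), add_sub_cancel_left,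
      add_sub_cancel_left, caret_mul D.len_pos.le, caret_mul E.len_pos.le, h _ ⟨hc0, hc1⟩]
  · rw [rot_out D 0 (by push_cast; linarith) (by push_cast; linarith), rot_out E 0]
    · push_cast; rw [add_zero, ← hr]; exact hg.monotone hx
    · push_cast; rw [add_zero, ← hl1]; exact hg.monotone h1

theorem rot_affOn_low (D : DyArc) : AffOn (rot D) (D.sub [false]) (D.sub [false, false]) := by
  intro u hu
  have := D.len_pos
  simp only [DyArc.sub_cons, DyArc.sub_nil, DyArc.child_left_false, DyArc.child_len]
  rw [rot_low D (by nlinarith [hu.1]) (by nlinarith [hu.2])]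
  ring

theorem rot_affOn_mid (D : DyArc) :
    AffOn (rot D) (D.sub [true, false]) (D.sub [false, true]) := by
  intro u hu
  have := D.len_pos
  simp only [DyArc.sub_cons, DyArc.sub_nil, DyArc.child_left_false, DyArc.child_left_true,
    DyArc.child_len]
  rw [rot_mid D (by nlinarith [hu.1]) (by nlinarith [hu.2])]
  ring

theorem rot_affOn_high (D : DyArc) : AffOn (rot D) (D.sub [true, true]) (D.sub [true]) := by
  intro u hu
  have := D.len_pos
  simp only [DyArc.sub_cons, DyArc.sub_nil, DyArc.child_left_true, DyArc.child_len]
  rw [rot_high D (by nlinarith [hu.1]) (by nlinarith [hu.2])]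
  ring

theorem rot_conj_low (D : DyArc) (w : List Bool) :
    rot D * rot (D.sub (false :: w)) = rot (D.sub (false :: false :: w)) * rot D :=
  ((rot_affOn_low D).sub w).conj (rot_strictMono D) (rot_add_one D)

theorem rot_conj_mid (D : DyArc) (w : List Bool) :
    rot D * rot (D.sub (true :: false :: w)) = rot (D.sub (false :: true :: w)) * rot D :=
  ((rot_affOn_mid D).sub w).conj (rot_strictMono D) (rot_add_one D)

theorem rot_conj_high (D : DyArc) (w : List Bool) :
    rot D * rot (D.sub (true :: true :: w)) = rot (D.sub (true :: w)) * rot D :=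
  ((rot_affOn_high D).sub w).conj (rot_strictMono D) (rot_add_one D)

/-- The pentagon relation: both sides re-bracket `a(b(cd))` to `((ab)c)d`. -/
theorem rot_pentagon (D : DyArc) :
    rot D * rot D = rot (D.sub [false]) * rot D * rot (D.sub [true]) := by
  refine homeo_ext_of_periodic (a := D.left) (fun x => ?_) (fun x => ?_) fun x h0 h1 => ?_
  · simp [rot_add_one]
  · simp [rot_add_one]
  have hs := D.len_pos
  have hs1 := D.len_le_one
  simp only [Homeomorph.mul_apply, DyArc.sub_cons, DyArc.sub_nil]
  have l0 : (D.child false).left = D.left := rfl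
  have l1 : (D.child true).left = D.left + D.len / 2 := rfl
  have e0 := D.child_len false
  have e1 := D.child_len true
  rcases le_total x (D.left + D.len / 2) with h | h
  · rw [rot_out (D.child true) 1 (by push_cast; linarith) (by push_cast; linarith),
      rot_low D h0 h, rot_low D (by linarith) (by linarith),
      rot_low (D.child false) (by linarith) (by linarith)]
    rw [l0]
  rcases le_total x (D.left + 3 * D.len / 4) with h' | h'
  · rw [rot_low (D.child true) (by linarith) (by linarith), rot_mid D h h',
      rot_low D (by linarith) (by linarith), rot_mid D (by linarith) (by linarith),
      rot_mid (D.child false) (by linarith) (by linarith)]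
    rw [l1, e0]
    ring
  rcases le_total x (D.left + 7 * D.len / 8) with h2 | h2
  · rw [rot_mid (D.child true) (by linarith) (by linarith), rot_high D h' (by linarith),
      rot_mid D (by linarith) (by linarith), rot_mid D (by linarith) (by linarith),
      rot_high (D.child false) (by linarith) (by linarith)]
    rw [e1, l0, e0]
    ring
  rcases le_total x (D.left + D.len) with h3 | h3
  · rw [rot_high (D.child true) (by linarith) (by linarith), rot_high D h' (by linarith),
      rot_high D (by linarith) (by linarith), rot_high D (by linarith) (by linarith),
      rot_out (D.child false) 0 (by push_cast; linarith) (by push_cast; linarith)]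
    rw [e1, l1]
    ring
  · have hx : rot D x = x := rot_out D 0 (by push_cast; linarith) (by push_cast; linarith)
    rw [rot_out (D.child true) 0 (by push_cast; linarith) (by push_cast; linarith), hx, hx,
      rot_out (D.child false) 0 (by push_cast; linarith) (by push_cast; linarith)]

/-- The relations among five basic elements that force the middle one to be trivial as soon as
the conjugating elements are central for them: the first three make `x01`, `x010` and `x011` equal,
and the pentagon relation then has two of them on one side and three on the other. -/
theorem eq_one_of_pentagon {K : Type*} [Group K] {x x0 x01 x001 x010 x011 : K}
    (h1 : x * x01 = x001 * x) (h2 : x0 * x010 = x001 * x0) (h3 : x0 * x011 = x01 * x0)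
    (hp : x01 * x01 = x010 * x01 * x011)
    (c1 : Commute x x01) (c2 : Commute x0 x010) (c3 : Commute x0 x011) : x01 = 1 := by
  have e1 : x001 = x01 := mul_right_cancel (b := x) (by rw [← h1, c1.eq])
  have e2 : x010 = x01 := mul_right_cancel (b := x0) (by rw [← c2.eq, h2, e1])
  have e3 : x011 = x01 := mul_right_cancel (b := x0) (by rw [← c3.eq, h3])
  rw [e2, e3] at hp
  simpa using hp

/-! ### Elements supported in an interval are products of rotations -/

/-- The group generated by the basic elements of `D`, its halves, its quarters, and so on. -/
def treeGroup (D : DyArc) : Subgroup (ℝ ≃ₜ ℝ) :=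
  Subgroup.closure (range fun w => rot (D.sub w))

theorem rot_sub_mem_treeGroup (D : DyArc) (w : List Bool) : rot (D.sub w) ∈ treeGroup D :=
  Subgroup.subset_closure ⟨w, rfl⟩

theorem treeGroup_child_le (D : DyArc) (b : Bool) : treeGroup (D.child b) ≤ treeGroup D := by
  rw [treeGroup, Subgroup.closure_le]
  rintro _ ⟨w, rfl⟩
  exact rot_sub_mem_treeGroup D (b :: w)

theorem treeGroup_le_thompsonGroup {D : DyArc} (hD : IsDyadic D.left) :
    treeGroup D ≤ thompsonGroup := by
  rw [treeGroup, Subgroup.closure_le]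
  rintro _ ⟨w, rfl⟩
  exact rot_mem (D.isDyadic_sub hD w)

theorem apply_eq_of_mem_closure {S : Set (ℝ ≃ₜ ℝ)} {x : ℝ} (h : ∀ g ∈ S, g x = x) {g : ℝ ≃ₜ ℝ}
    (hg : g ∈ Subgroup.closure S) : g x = x := by
  induction hg using Subgroup.closure_induction with
  | mem g hg => exact h g hg
  | one => rfl
  | mul g g' _ _ h1 h2 => rw [Homeomorph.mul_apply, h2, h1]
  | inv g _ h1 =>
    apply g.injective
    rw [← Homeomorph.mul_apply, mul_inv_cancel, Homeomorph.one_apply, h1]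

/-- The elements of `treeGroup D` fix the points outside the interior of `D + ℤ`. -/
theorem apply_eq_of_mem_treeGroup {D : DyArc} {g : ℝ ≃ₜ ℝ} (hg : g ∈ treeGroup D) {x : ℝ} (k : ℤ)
    (h0 : D.left + D.len ≤ x + k) (h1 : x + k ≤ D.left + 1) : g x = x := by
  refine apply_eq_of_mem_closure ?_ hg
  rintro _ ⟨w, rfl⟩
  refine rot_out' _ fun l => ?_
  rintro ⟨h2, h3⟩
  have h4 := D.left_le_sub w
  have h5 := D.right_sub_le w
  have h6 : l < k := by
    have : (l : ℝ) < k := by linarith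
    exact_mod_cast this
  have h7 : k - 1 < l := by
    have : ((k - 1 : ℤ) : ℝ) < l := by push_cast; linarith
    exact_mod_cast this
  omega

/-- The subdivision of the unit interval into `n + 1` pieces at the points `1/2`, `3/4`, `7/8`, …:
the piece with number `i` is parametrized affinely by `[i, i + 1]`. -/
noncomputable def comb : ℕ → ℝ → ℝ
  | 0, x => x
  | n + 1, x => if x ≤ 1 then x / 2 else 1 / 2 + comb n (x - 1) / 2

theorem comb_zero_right (n : ℕ) : comb n 0 = 0 := by
  cases n <;> simp [comb]

theorem comb_succ_low (n : ℕ) {x : ℝ} (h : x ≤ 1) : comb (n + 1) x = x / 2 := by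
  simp [comb, h]

theorem comb_succ_high (n : ℕ) {x : ℝ} (h : 1 ≤ x) :
    comb (n + 1) x = 1 / 2 + comb n (x - 1) / 2 := by
  rcases h.lt_or_eq with h | rfl
  · simp [comb, h.not_ge]
  · simp [comb, comb_zero_right]

theorem comb_mem (n : ℕ) {x : ℝ} (h0 : 0 ≤ x) (h1 : x ≤ n + 1) : 0 ≤ comb n x ∧ comb n x ≤ 1 := by
  induction n generalizing x with
  | zero => simpa [comb, h0] using h1
  | succ n ih =>
    rcases le_total x 1 with h | h
    · rw [comb_succ_low n h]; constructor <;> linarith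
    · rw [comb_succ_high n h]
      have := ih (x := x - 1) (by linarith) (by push_cast at h1; linarith)
      constructor <;> linarith

/-- Two combs hanging from the halves of `D` can be rotated into a single comb. -/
theorem exists_join_combs (k n : ℕ) (D : DyArc) : ∃ γ ∈ treeGroup D,
    (∀ x ∈ Icc (0 : ℝ) (k + 1),
      γ (D.left + D.len / 2 * comb k x) = D.left + D.len * comb (k + n + 1) x) ∧
    ∀ x ∈ Icc (0 : ℝ) (n + 1), γ (D.left + D.len / 2 + D.len / 2 * comb n x) =
      D.left + D.len * comb (k + n + 1) (k + 1 + x) := by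
  induction k generalizing D with
  | zero =>
    refine ⟨1, one_mem _, fun x hx => ?_, fun x hx => ?_⟩
    · rw [comb_succ_low _ (by simpa using hx.2)]
      simp [comb]; ring
    · rw [comb_succ_high _ (by simpa using hx.1)]
      simp; ring
  | succ k ih =>
    obtain ⟨γ, hγ, hl, hr⟩ := ih (D.child true)
    have hs := D.len_pos
    have hs1 := D.len_le_one
    simp only [DyArc.child_left_true, DyArc.child_len] at hl hr
    refine ⟨γ * (rot D)⁻¹, mul_mem (treeGroup_child_le D true hγ)
      (inv_mem (rot_sub_mem_treeGroup D [])), fun x hx => ?_, fun x hx => ?_⟩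
    · rw [show k + 1 + n + 1 = (k + n + 1) + 1 by ring, Homeomorph.mul_apply]
      rcases le_total x 1 with h | h
      · have : (rot D)⁻¹ (D.left + D.len / 2 * comb (k + 1) x) = D.left + D.len / 2 * x := by
          apply (rot D).injective
          rw [← Homeomorph.mul_apply, mul_inv_cancel, Homeomorph.one_apply,
            rot_low D (by nlinarith [hx.1]) (by nlinarith), comb_succ_low _ h]
          ring
        rw [this, apply_eq_of_mem_treeGroup hγ 1, comb_succ_low _ h]
        · ring
        · simp; nlinarith [hx.1]
        · simp; nlinarith
      · have hm := comb_mem k (x := x - 1) (by linarith) (by have := hx.2; push_cast at this; linarith)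
        have : (rot D)⁻¹ (D.left + D.len / 2 * comb (k + 1) x) =
            D.left + D.len / 2 + D.len / 2 / 2 * comb k (x - 1) := by
          apply (rot D).injective
          rw [← Homeomorph.mul_apply, mul_inv_cancel, Homeomorph.one_apply,
            rot_mid D (by nlinarith) (by nlinarith), comb_succ_high _ h]
          ring
        rw [this, hl _ ⟨by linarith, by have := hx.2; push_cast at this; linarith⟩,
          comb_succ_high _ h]
        ring
    · rw [show k + 1 + n + 1 = (k + n + 1) + 1 by ring, Homeomorph.mul_apply]
      have hm := comb_mem n hx.1 hx.2
      have : (rot D)⁻¹ (D.left + D.len / 2 + D.len / 2 * comb n x) =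
          D.left + D.len / 2 + D.len / 2 / 2 + D.len / 2 / 2 * comb n x := by
        apply (rot D).injective
        rw [← Homeomorph.mul_apply, mul_inv_cancel, Homeomorph.one_apply,
          rot_high D (by nlinarith) (by nlinarith)]
        ring
      rw [this, hr x hx, comb_succ_high (k + n + 1) (by push_cast; linarith [hx.1, (k.cast_nonneg : (0:ℝ) ≤ k)])]
      push_cast
      rw [show (k : ℝ) + 1 + 1 + x - 1 = k + 1 + x by ring]
      ring

/-- `ψ` parametrizes a subdivision of `D` into `n + 1` standard dyadic subintervals, affinely on
each interval `[i, i + 1]`. -/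
def IsSubdiv (ψ : ℝ → ℝ) (n : ℕ) (D : DyArc) : Prop :=
  ψ 0 = D.left ∧ ψ (n + 1) = D.left + D.len ∧ ∀ i : ℕ, i ≤ n → ∃ l j : ℕ, ∀ x ∈ Icc (0 : ℝ) 1,
    ψ (i + x) = D.left + D.len * ((j + x) / 2 ^ l)

theorem IsSubdiv.lt_succ {ψ : ℝ → ℝ} {n : ℕ} {D : DyArc} (h : IsSubdiv ψ n D) {i : ℕ} (hi : i ≤ n) :
    ψ i < ψ (i + 1 : ℕ) := by
  obtain ⟨l, j, hj⟩ := h.2.2 i hi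
  have h0 := hj 0 (by simp)
  have h1 := hj 1 (by simp)
  rw [add_zero] at h0
  push_cast
  rw [h0, h1]
  have := D.len_pos
  gcongr
  linarith

theorem IsSubdiv.le_add {ψ : ℝ → ℝ} {n : ℕ} {D : DyArc} (h : IsSubdiv ψ n D) {i d : ℕ}
    (hi : i + d ≤ n + 1) : ψ i ≤ ψ (i + d : ℕ) := by
  induction d with
  | zero => simp
  | succ d ih =>
    have h1 := ih (by omega)
    have h2 := h.lt_succ (i := i + d) (by omega)
    rw [← add_assoc]
    exact h1.trans h2.le

theorem IsSubdiv.le_of_le {ψ : ℝ → ℝ} {n : ℕ} {D : DyArc} (h : IsSubdiv ψ n D) {i j : ℕ}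
    (hij : i ≤ j) (hj : j ≤ n + 1) : ψ i ≤ ψ j := by
  obtain ⟨d, rfl⟩ := Nat.exists_eq_add_of_le hij
  exact h.le_add hj

theorem IsSubdiv.mem {ψ : ℝ → ℝ} {n : ℕ} {D : DyArc} (h : IsSubdiv ψ n D) {x : ℝ} (h0 : 0 ≤ x)
    (h1 : x ≤ n + 1) : D.left ≤ ψ x ∧ ψ x ≤ D.left + D.len := by
  have hs := D.len_pos
  obtain ⟨i, u, hi, hu, rfl⟩ : ∃ (i : ℕ) (u : ℝ), i ≤ n ∧ u ∈ Icc (0 : ℝ) 1 ∧ x = i + u := by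
    rcases h1.lt_or_eq with h1 | rfl
    · refine ⟨⌊x⌋₊, x - ⌊x⌋₊, ?_, ⟨by linarith [Nat.floor_le h0], by linarith [Nat.lt_floor_add_one x]⟩,
        by ring⟩
      rw [← Nat.lt_succ_iff, Nat.floor_lt h0]
      exact_mod_cast h1
    · exact ⟨n, 1, le_rfl, by simp, rfl⟩
  obtain ⟨l, j, hj⟩ := h.2.2 i hi
  have h1 := hj 1 (by simp)
  have h2 := h.le_of_le (i := i + 1) (j := n + 1) (by omega) le_rfl
  push_cast at h2
  rw [h1, h.2.1] at h2
  rw [hj u hu]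
  constructor
  · have : 0 ≤ D.len * ((j + u) / 2 ^ l) := by
      have := hu.1; positivity
    linarith
  · refine le_trans ?_ h2
    gcongr
    exact hu.2

/-- Any subdivision of `D` with `n + 1` pieces is carried to the comb with `n + 1` pieces. -/
theorem IsSubdiv.exists_comb (n : ℕ) : ∀ (D : DyArc) (ψ : ℝ → ℝ), IsSubdiv ψ n D →
    ∃ γ ∈ treeGroup D, ∀ x ∈ Icc (0 : ℝ) (n + 1), γ (ψ x) = D.left + D.len * comb n x := by
  induction n using Nat.strong_induction_on with
  | _ n ih =>
  intro D ψ h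
  have hs := D.len_pos
  have hs1 := D.len_le_one
  -- `k'` is the last index whose breakpoint is not in the interior of the right half of `D`
  obtain ⟨k', hk'n, hk', hk'1⟩ : ∃ k' ≤ n, ψ k' ≤ D.left + D.len / 2 ∧
      D.left + D.len / 2 < ψ (k' + 1 : ℕ) := by
    classical
    let P : ℕ → Prop := fun i => ψ i ≤ D.left + D.len / 2
    have h0 : P 0 := by simp only [P, Nat.cast_zero, h.1]; linarith
    have h1 : P (Nat.findGreatest P n) := Nat.findGreatest_spec (Nat.zero_le n) h0
    refine ⟨Nat.findGreatest P n, Nat.findGreatest_le n, h1, ?_⟩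
    by_contra hc
    rcases (Nat.findGreatest_le (P := P) n).lt_or_eq with h2 | h2
    · exact Nat.findGreatest_is_greatest (P := P) (Nat.lt_succ_self _) h2 (not_lt.1 hc)
    · rw [h2] at hc
      push_cast at hc
      rw [h.2.1] at hc
      linarith
  rcases Nat.eq_zero_or_pos n with rfl | hn
  · obtain ⟨l, j, hj⟩ := h.2.2 0 le_rfl
    have e0 := hj 0 (by simp)
    have e1 := hj 1 (by simp)
    have h0 := h.1
    have h1 := h.2.1
    simp only [Nat.cast_zero, zero_add, add_zero] at e0 e1 h1
    rw [e0] at h0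
    rw [e1] at h1
    have h0' : (j : ℝ) / 2 ^ l = 0 := by
      have : D.len * (j / 2 ^ l) = 0 := by linarith
      exact (mul_eq_zero.1 this).resolve_left hs.ne'
    have h1' : ((j : ℝ) + 1) / 2 ^ l = 1 := by
      have : D.len * ((j + 1) / 2 ^ l - 1) = 0 := by linarith
      linarith [(mul_eq_zero.1 this).resolve_left hs.ne']
    refine ⟨1, one_mem _, fun x hx => ?_⟩
    have := hj x (by simpa using hx)
    simp only [Nat.cast_zero, zero_add] at this
    rw [Homeomorph.one_apply, this]
    congr 2
    rw [add_div, h0'] at *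
    simp only [zero_add, comb] at *
    rw [div_eq_mul_one_div, h1', mul_one]
  -- no piece is all of `D`
  have hpiece : ∀ i : ℕ, i ≤ n → ∃ l j : ℕ, ∀ x ∈ Icc (0 : ℝ) 1,
      ψ (i + x) = D.left + D.len * ((j + x) / 2 ^ (l + 1)) := by
    intro i hi
    obtain ⟨l, j, hj⟩ := h.2.2 i hi
    rcases l with - | l
    · exfalso
      have e0 := hj 0 (by simp)
      have e1 := hj 1 (by simp)
      simp only [add_zero, pow_zero, div_one] at e0 e1
      rcases Nat.eq_zero_or_pos i with rfl | hi0
      · have h1 := h.le_of_le (i := 2) (j := n + 1) (by omega) le_rfl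
        have h2 := h.lt_succ (i := 1) (by omega)
        push_cast at h1 h2 e1
        rw [h.2.1] at h1
        norm_num at h2 e1
        rw [e1] at h2
        have : 0 ≤ D.len * j := by positivity
        nlinarith
      · have h1 := h.le_of_le (i := i + 1) (j := n + 1) (by omega) le_rfl
        have h2 := h.le_of_le (i := 1) (j := i) (by omega) (by omega)
        have h3 := h.lt_succ (i := 0) (by omega)
        push_cast at h1 h2 h3
        rw [h.2.1, e1] at h1
        rw [h.1] at h3
        nlinarith
    · exact ⟨l, j, hj⟩
  -- hence the midpoint of `D` is a breakpoint
  have hmid : ψ k' = D.left + D.len / 2 := by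
    obtain ⟨l, j, hj⟩ := hpiece k' hk'n
    have e0 := hj 0 (by simp)
    have e1 := hj 1 (by simp)
    simp only [add_zero] at e0
    push_cast at hk'1
    rw [e1] at hk'1
    rw [e0] at hk' ⊢
    have h2 : (0 : ℝ) < 2 ^ l := by positivity
    have a0 : (j : ℝ) / 2 ^ (l + 1) ≤ 1 / 2 := by nlinarith
    have a1 : 1 / 2 < ((j : ℝ) + 1) / 2 ^ (l + 1) := by nlinarith
    rw [pow_succ, div_le_div_iff₀ (by positivity) (by positivity)] at a0
    rw [pow_succ, div_lt_div_iff₀ (by positivity) (by positivity)] at a1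
    have b0 : j ≤ 2 ^ l := by
      have : (j : ℝ) ≤ 2 ^ l := by linarith
      exact_mod_cast this
    have b1 : 2 ^ l < j + 1 := by
      have : (2 : ℝ) ^ l < j + 1 := by linarith
      exact_mod_cast this
    have : j = 2 ^ l := by omega
    rw [this, pow_succ]
    push_cast
    field_simp
  obtain ⟨k, rfl⟩ : ∃ k, k' = k + 1 := by
    refine Nat.exists_eq_succ_of_ne_zero ?_
    rintro rfl
    rw [Nat.cast_zero, h.1] at hmid
    linarith
  obtain ⟨m, rfl⟩ : ∃ m, n = k + m + 1 := ⟨n - (k + 1), by omega⟩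
  push_cast at hmid
  have hL : IsSubdiv ψ k (D.child false) := by
    refine ⟨h.1, by simpa using hmid, fun i hi => ?_⟩
    obtain ⟨l, j, hj⟩ := hpiece i (by omega)
    refine ⟨l, j, fun x hx => ?_⟩
    rw [hj x hx, DyArc.child_left_false, DyArc.child_len, pow_succ]
    field_simp
  have hR : IsSubdiv (fun x => ψ (k + 1 + x)) m (D.child true) := by
    refine ⟨by simpa using hmid, ?_, fun i hi => ?_⟩
    · have := h.2.1
      push_cast at this
      rw [DyArc.child_left_true, DyArc.child_len, add_assoc D.left, add_halves, ← this]
      show ψ _ = ψ _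
      congr 1; ring
    obtain ⟨l, j, hj⟩ := hpiece (k + 1 + i) (by omega)
    have hge := h.le_of_le (i := k + 1) (j := k + 1 + i) (by omega) (by omega)
    have e0 := hj 0 (by simp)
    push_cast at hge e0 hj
    rw [add_zero, add_zero] at e0
    rw [hmid, e0] at hge
    have a0 : 1 / 2 ≤ (j : ℝ) / 2 ^ (l + 1) := by
      by_contra hc
      push Not at hc
      nlinarith
    rw [pow_succ, div_le_div_iff₀ (by positivity) (by positivity)] at a0
    have b0 : 2 ^ l ≤ j := by
      have : (2 : ℝ) ^ l ≤ j := by linarith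
      exact_mod_cast this
    obtain ⟨j', rfl⟩ := Nat.exists_eq_add_of_le b0
    refine ⟨l, j', fun x hx => ?_⟩
    simp only [← add_assoc]
    rw [hj x hx, DyArc.child_left_true, DyArc.child_len, pow_succ]
    push_cast
    field_simp
    ring
  obtain ⟨γl, hγl, hl⟩ := ih k (by omega) _ _ hL
  obtain ⟨γr, hγr, hr⟩ := ih m (by omega) _ _ hR
  obtain ⟨γ, hγ, hjl, hjr⟩ := exists_join_combs k m D
  refine ⟨γ * γl * γr, mul_mem (mul_mem hγ (treeGroup_child_le D _ hγl))
    (treeGroup_child_le D _ hγr), fun x hx => ?_⟩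
  rw [Homeomorph.mul_apply, Homeomorph.mul_apply]
  rcases le_total x (k + 1) with hxk | hxk
  · have hm := hL.mem hx.1 hxk
    simp only [DyArc.child_left_false, DyArc.child_len] at hm
    rw [apply_eq_of_mem_treeGroup hγr 1 (by simp; linarith) (by simp; linarith), hl x ⟨hx.1, hxk⟩]
    simp only [DyArc.child_left_false, DyArc.child_len]
    exact hjl x ⟨hx.1, hxk⟩
  · obtain ⟨y, rfl⟩ : ∃ y, x = k + 1 + y := ⟨x - (k + 1), by ring⟩
    have hy0 : 0 ≤ y := by linarith
    have hy1 : y ≤ m + 1 := by have := hx.2; push_cast at this; linarith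
    have hc := comb_mem m hy0 hy1
    rw [hr y ⟨hy0, hy1⟩]
    simp only [DyArc.child_left_true, DyArc.child_len]
    rw [apply_eq_of_mem_treeGroup hγl 0 (by simp; nlinarith) (by simp; nlinarith)]
    exact hjr y ⟨hy0, hy1⟩

/-- An element of Thompson's group supported in `D + ℤ` cuts `D` into standard pieces. -/
theorem eventually_isSubdiv {f : ℝ ≃ₜ ℝ} (hf : f ∈ thompsonLift) {D : DyArc} (hD : IsDyadic D.left)
    (hfix : ∀ x, D.left + D.len ≤ x → x ≤ D.left + 1 → f x = x) :
    ∀ᶠ M : ℕ in atTop, ∀ n t : ℕ, M = D.level + t → n + 1 = 2 ^ t →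
      IsSubdiv (fun x => f (D.left + x / 2 ^ M)) n D := by
  obtain ⟨K, hK, hKl⟩ := (hD.eventually.and (eventually_ge_atTop D.level)).exists
  filter_upwards [thompsonLift.isStd hf K, hD.eventually] with M hM hc n t hMt hn
  obtain ⟨c, hc⟩ := hc
  have hs := D.len_pos
  have hfl : f D.left = D.left := by
    have := hfix (D.left + 1) (by linarith [D.len_le_one]) le_rfl
    rw [hf.2.1] at this
    linarith
  have hlen : D.len = (n + 1) / 2 ^ M := by
    have : (n : ℝ) + 1 = 2 ^ t := by exact_mod_cast hn
    rw [this, hMt, pow_add, DyArc.len]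
    field_simp
  refine ⟨by simpa using hfl, ?_, fun i hi => ?_⟩
  · show f _ = _
    rw [← hlen]
    exact hfix _ le_rfl (by linarith [D.len_le_one])
  obtain ⟨k, hk, j, hj⟩ := hM (c + i)
  obtain ⟨b, hb⟩ := hK
  obtain ⟨d, rfl⟩ := Nat.exists_eq_add_of_le hk
  obtain ⟨e, rfl⟩ := Nat.exists_eq_add_of_le hKl
  have hpos : 0 ≤ j - b * 2 ^ d := by
    have h0 := hj 0 (by simp)
    have h1 : D.left ≤ f (((c + i : ℤ) + 0) / 2 ^ M) := by
      conv_lhs => rw [← hfl]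
      apply hf.1.monotone
      rw [hc]; push_cast; gcongr; linarith [(i.cast_nonneg : (0 : ℝ) ≤ i)]
    rw [h0, hb, pow_add _ (D.level + e) d, div_le_div_iff₀ (by positivity) (by positivity)] at h1
    have h2 : (b : ℝ) * 2 ^ d ≤ j := by
      have : (0 : ℝ) < 2 ^ (D.level + e) := by positivity
      nlinarith
    have : b * 2 ^ d ≤ j := by exact_mod_cast h2
    omega
  obtain ⟨j', hj'⟩ := Int.eq_ofNat_of_zero_le hpos
  have hj2 : (j : ℝ) = j' + b * 2 ^ d := by
    have : j = j' + b * 2 ^ d := by linarith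
    exact_mod_cast this
  refine ⟨e + d, j', fun x hx => ?_⟩
  have := hj x hx
  simp only
  rw [show D.left + ((i : ℝ) + x) / 2 ^ M = ((c + i : ℤ) + x) / 2 ^ M by
    rw [hc]; push_cast; ring, this, hb, hj2, DyArc.len]
  rw [pow_add, pow_add, pow_add]
  field_simp
  ring

/-- An element of Thompson's group supported in `D + ℤ` is a product of rotations inside `D`. -/
theorem mem_treeGroup {f : ℝ ≃ₜ ℝ} (hf : f ∈ thompsonLift) {D : DyArc} (hD : IsDyadic D.left)
    (hfix : ∀ x, D.left + D.len ≤ x → x ≤ D.left + 1 → f x = x) : f ∈ treeGroup D := by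
  obtain ⟨M, ⟨h1, h2⟩, hM⟩ := ((eventually_isSubdiv hf hD hfix).and
    (eventually_isSubdiv thompsonLift.one_mem hD (fun _ _ _ => rfl))).and
    (eventually_ge_atTop D.level) |>.exists
  obtain ⟨t, ht⟩ := Nat.exists_eq_add_of_le hM
  obtain ⟨n, hn⟩ : ∃ n, n + 1 = 2 ^ t :=
    ⟨2 ^ t - 1, Nat.sub_add_cancel Nat.one_le_two_pow⟩
  obtain ⟨γ, hγ, h⟩ := (h1 n t ht hn).exists_comb
  obtain ⟨γ', hγ', h'⟩ := (h2 n t ht hn).exists_comb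
  have hle := treeGroup_le_thompsonGroup hD
  have hlen : D.len * 2 ^ M = n + 1 := by
    have : (n : ℝ) + 1 = 2 ^ t := by exact_mod_cast hn
    rw [this, ht, pow_add, DyArc.len]
    field_simp
  have key : γ * f = γ' := by
    refine homeo_ext_of_periodic (a := D.left) (mul_mem (hle hγ) hf).2.1 (hle hγ').2.1
      fun x h0 h3 => ?_
    rw [Homeomorph.mul_apply]
    rcases le_total x (D.left + D.len) with hx | hx
    · have hP : (0 : ℝ) < 2 ^ M := by positivity
      have hmem : (x - D.left) * 2 ^ M ∈ Icc (0 : ℝ) (n + 1) :=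
        ⟨mul_nonneg (by linarith) hP.le, by rw [← hlen]; gcongr; linarith⟩
      have e1 := h _ hmem
      have e2 := h' _ hmem
      rw [mul_div_cancel_right₀ _ hP.ne', add_sub_cancel] at e1 e2
      rw [e1, ← e2, Homeomorph.one_apply]
    · rw [hfix x hx h3, apply_eq_of_mem_treeGroup hγ 0 (by simpa) (by simpa),
        apply_eq_of_mem_treeGroup hγ' 0 (by simpa) (by simpa)]
  rw [← eq_inv_mul_iff_mul_eq] at key
  rw [key]
  exact mul_mem (inv_mem hγ) hγ'

/-! ### Generation of the lift of Thompson's group -/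

theorem shift_mem {d : ℝ} (hd : IsDyadic d) : Homeomorph.addRight d ∈ thompsonLift :=
  ⟨fun x y h => by simpa using h, fun x => by simp; ring, ∅, by simp, fun x _ =>
    ⟨0, d, hd, by simp⟩⟩

theorem zpow_apply_of_apply_eq {σ : ℝ ≃ₜ ℝ} {x : ℝ} (h : σ x = x) (k : ℤ) : (σ ^ k) x = x := by
  refine apply_eq_of_mem_closure (S := {σ}) (fun g hg => ?_)
    (zpow_mem (Subgroup.subset_closure (Set.mem_singleton σ)) k)
  rw [Set.mem_singleton_iff.1 hg, h]

section Generation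

variable {Γ : Subgroup (ℝ ≃ₜ ℝ)} {m₀ : ℕ}

/-- The group generated by the basic elements of short intervals is transitive on dyadic points. -/
theorem exists_apply_eq_zero (hΓ : ∀ D : DyArc, IsDyadic D.left → m₀ ≤ D.level → rot D ∈ Γ) {p : ℝ}
    (hp : IsDyadic p) : ∃ γ ∈ Γ, γ p = 0 := by
  obtain ⟨M, ⟨c, rfl⟩, hM⟩ := (hp.eventually.and (eventually_ge_atTop (m₀ + 2))).exists
  obtain ⟨m, rfl⟩ : ∃ m, M = m + 2 := ⟨M - 2, by omega⟩
  have hlen : ∀ a : ℝ, (⟨a, m⟩ : DyArc).len = 4 / 2 ^ (m + 2) := by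
    intro a; rw [DyArc.len, pow_add]; norm_num; field_simp
  have hd : IsDyadic (1 / 2 ^ (m + 2)) := ⟨1, m + 2, by simp⟩
  -- `rot D` moves the midpoint of `D` to the left by a quarter of the length of `D`
  have step : ∀ c : ℤ, ∃ γ ∈ Γ, γ (((c + 1 : ℤ) : ℝ) / 2 ^ (m + 2)) = c / 2 ^ (m + 2) := by
    intro c
    refine ⟨rot ⟨(c - 1) / 2 ^ (m + 2), m⟩, hΓ _ ⟨c - 1, m + 2, by push_cast; ring⟩ (by simp; omega), ?_⟩
    rw [rot_mid]
    · rw [hlen]; push_cast; ring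
    · rw [hlen]; apply le_of_eq; push_cast; ring
    · rw [hlen]
      have : (0 : ℝ) < 1 / 2 ^ (m + 2) := by positivity
      push_cast
      rw [show ((c : ℝ) - 1) / 2 ^ (m + 2) + 3 * (4 / 2 ^ (m + 2)) / 4 =
        (c + 1) / 2 ^ (m + 2) + 1 / 2 ^ (m + 2) by ring]
      linarith
  clear hp
  induction c using Int.induction_on with
  | zero => exact ⟨1, one_mem _, by simp⟩
  | succ i ih =>
    obtain ⟨γ, hγ, h⟩ := ih
    obtain ⟨δ, hδ, h'⟩ := step i
    exact ⟨γ * δ, mul_mem hγ hδ, by rw [Homeomorph.mul_apply, h', h]⟩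
  | pred i ih =>
    obtain ⟨γ, hγ, h⟩ := ih
    obtain ⟨δ, hδ, h'⟩ := step (-i - 1)
    refine ⟨γ * δ⁻¹, mul_mem hγ (inv_mem hδ), ?_⟩
    rw [Homeomorph.mul_apply, ← h', ← Homeomorph.mul_apply δ⁻¹, inv_mul_cancel, sub_add_cancel]
    exact h

/-- A homeomorphism with slope `1/2` at a fixed point `0` on the side given by `ε` can be used to
straighten any germ on this side whose slope is a power of two. -/
theorem exists_zpow_straighten {σ g : ℝ ≃ₜ ℝ} {ε c η : ℝ} (hc : 0 < c) (hη : 0 < η) {a : ℤ}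
    (hσ : ∀ x, 0 ≤ x → x ≤ c → σ (ε * x) = ε * (x / 2))
    (hg : ∀ x, 0 ≤ x → x ≤ η → g (ε * x) = ε * (2 ^ a * x)) :
    ∃ k : ℤ, ∃ η' > 0, ∀ x, 0 ≤ x → x ≤ η' → (σ ^ k) (g (ε * x)) = ε * x := by
  have hpow : ∀ n : ℕ, ∀ x, 0 ≤ x → x ≤ c → (σ ^ n) (ε * x) = ε * (x / 2 ^ n) := by
    intro n x h0 h1
    induction n with
    | zero => simp
    | succ n ih =>
      rw [pow_succ', Homeomorph.mul_apply, ih, hσ _ (by positivity)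
        ((div_le_self h0 (one_le_pow₀ (by norm_num))).trans h1), pow_succ]
      ring
  rcases le_total 0 a with ha | ha
  · obtain ⟨n, rfl⟩ := Int.eq_ofNat_of_zero_le ha
    refine ⟨n, min η (c / 2 ^ n), by positivity, fun x h0 h1 => ?_⟩
    have h2 := h1.trans (min_le_right _ _)
    rw [le_div_iff₀ (by positivity)] at h2
    rw [hg x h0 (h1.trans (min_le_left _ _)), zpow_natCast, zpow_natCast,
      hpow n _ (by positivity) (by linarith), mul_div_cancel_left₀ _ (by positivity)]
  · obtain ⟨n, hn⟩ := Int.eq_ofNat_of_zero_le (neg_nonneg.2 ha)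
    obtain rfl : a = -n := by omega
    refine ⟨-n, min η c, by positivity, fun x h0 h1 => ?_⟩
    rw [hg x h0 (h1.trans (min_le_left _ _)), zpow_neg, zpow_neg, zpow_natCast, zpow_natCast]
    apply (σ ^ n).injective
    rw [← Homeomorph.mul_apply, mul_inv_cancel, Homeomorph.one_apply,
      hpow n _ h0 (h1.trans (min_le_right _ _))]
    ring

/-- The factors `1` are there for the form required by `exists_zpow_straighten`. -/
theorem exists_germ_right {g : ℝ ≃ₜ ℝ} (hg : g ∈ thompsonLift) (h0 : g 0 = 0) :
    ∃ η > 0, ∃ a : ℤ, ∀ x, 0 ≤ x → x ≤ η → g (1 * x) = 1 * (2 ^ a * x) := by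
  obtain ⟨M, hM⟩ := (thompsonLift.isStd hg 0).exists
  obtain ⟨k, -, j, hj⟩ := hM 0
  have hj0 : (j : ℝ) = 0 := by
    have := hj 0 (by simp)
    rw [Int.cast_zero, add_zero, zero_div, h0, add_zero, eq_comm, div_eq_zero_iff] at this
    exact this.resolve_right (by positivity)
  refine ⟨1 / 2 ^ M, by positivity, M - k, fun x hx0 hx1 => ?_⟩
  rw [le_div_iff₀ (by positivity)] at hx1
  have := hj (x * 2 ^ M) ⟨by positivity, hx1⟩
  rw [hj0, Int.cast_zero, zero_add, mul_div_cancel_right₀ _ (by positivity)] at this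
  rw [one_mul, this, zpow_sub₀ (by norm_num), zpow_natCast, zpow_natCast]
  ring

theorem exists_germ_left {g : ℝ ≃ₜ ℝ} (hg : g ∈ thompsonLift) (h0 : g 0 = 0) :
    ∃ η > 0, ∃ a : ℤ, ∀ x, 0 ≤ x → x ≤ η → g (-1 * x) = -1 * (2 ^ a * x) := by
  obtain ⟨M, hM⟩ := (thompsonLift.isStd hg 0).exists
  obtain ⟨k, -, j, hj⟩ := hM (-1)
  have hj0 : (j : ℝ) = -1 := by
    have := hj 1 (by simp)
    rw [Int.cast_neg, Int.cast_one, neg_add_cancel, zero_div, h0, eq_comm, div_eq_zero_iff] at this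
    linarith [this.resolve_right (by positivity)]
  refine ⟨1 / 2 ^ M, by positivity, M - k, fun x hx0 hx1 => ?_⟩
  rw [le_div_iff₀ (by positivity)] at hx1
  have := hj (1 - x * 2 ^ M) ⟨by linarith, by nlinarith [show (0 : ℝ) < 2 ^ M by positivity]⟩
  rw [hj0, show (((-1 : ℤ) : ℝ) + (1 - x * 2 ^ M)) / 2 ^ M = -1 * x by push_cast; field_simp; ring]
    at this
  rw [this, zpow_sub₀ (by norm_num), zpow_natCast, zpow_natCast]
  ring

/-- An element supported in a proper interval is conjugated, by pushing the right end of the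
support to the left, into an element supported in a short interval. -/
theorem mem_of_support (hΓ : ∀ D : DyArc, IsDyadic D.left → m₀ ≤ D.level → rot D ∈ Γ)
    {E : DyArc} (hE : IsDyadic E.left) (hm : m₀ ≤ E.level) (j : ℕ)
    (hj : ((j : ℝ) + 2) * (E.len / 4) ≤ 1) {h : ℝ ≃ₜ ℝ} (hh : h ∈ thompsonLift)
    (hfix : ∀ x, E.left + j * (E.len / 4) ≤ x → x ≤ E.left + 1 → h x = x) : h ∈ Γ := by
  have hs := E.len_pos
  induction j generalizing h with
  | zero =>
    have : h ∈ treeGroup E := mem_treeGroup hh hE fun x h0 h1 => hfix x (by simp; linarith) h1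
    refine (Subgroup.closure_le _).2 ?_ this
    rintro _ ⟨w, rfl⟩
    exact hΓ _ (E.isDyadic_sub hE w) (hm.trans (E.level_le_sub w))
  | succ j ih =>
    rcases le_or_gt (j + 1) 4 with hj4 | hj4
    · have hj4' : ((j + 1 : ℕ) : ℝ) ≤ 4 := by exact_mod_cast hj4
      have : h ∈ treeGroup E := mem_treeGroup hh hE fun x h0 h1 => hfix x (by nlinarith) h1
      refine (Subgroup.closure_le _).2 ?_ this
      rintro _ ⟨w, rfl⟩
      exact hΓ _ (E.isDyadic_sub hE w) (hm.trans (E.level_le_sub w))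
    have hj4' : (4 : ℝ) ≤ j := by exact_mod_cast (by omega : 4 ≤ j)
    push_cast at hj hfix
    have hq : IsDyadic (E.len / 4) := ⟨1, E.level + 2, by
      rw [DyArc.len, pow_add]; norm_num; field_simp⟩
    let D : DyArc := ⟨E.left + (j - 1) * (E.len / 4), E.level⟩
    have hDl : D.left = E.left + (j - 1) * (E.len / 4) := rfl
    have hDn : D.len = E.len := rfl
    have hD : IsDyadic D.left := by
      obtain ⟨a, k, ha⟩ := hq
      rw [hDl, ha]
      exact hE.add ⟨(j - 1) * a, k, by push_cast; ring⟩
    have hrD := hΓ D hD hm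
    have hX : rot D * h * (rot D)⁻¹ ∈ Γ := by
      refine ih (by linarith) (thompsonLift.mul_mem (thompsonLift.mul_mem (rot_mem hD) hh)
        (thompsonLift.inv_mem (rot_mem hD))) fun x h0 h1 => ?_
      obtain ⟨y, rfl⟩ := (rot D).surjective x
      have e : rot D (E.left + (j + 1) * (E.len / 4)) = E.left + j * (E.len / 4) := by
        rw [rot_mid D (by rw [hDl, hDn]; linarith) (by rw [hDl, hDn]; linarith), hDn]
        ring
      have e1 : rot D (E.left + 1) = E.left + 1 :=
        rot_out D 0 (by rw [hDl, hDn]; push_cast; linarith)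
          (by rw [hDl]; push_cast; nlinarith)
      rw [← e, (rot_strictMono D).le_iff_le] at h0
      rw [← e1, (rot_strictMono D).le_iff_le] at h1
      have hy : (rot D)⁻¹ (rot D y) = y := (rot D).symm_apply_apply y
      rw [Homeomorph.mul_apply, Homeomorph.mul_apply, hy, hfix y h0 h1]
    have := mul_mem (mul_mem (inv_mem hrD) hX) hrD
    simpa [mul_assoc] using this

/-- A given element of Thompson's group is modified by basic elements of short intervals: first to fix
`0`, then to be the identity near `0`; then `mem_of_support` applies. -/
theorem thompsonGroup_le_of_le (hle : Γ ≤ thompsonGroup) (hm₀ : 1 ≤ m₀)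
    (hΓ : ∀ D : DyArc, IsDyadic D.left → m₀ ≤ D.level → rot D ∈ Γ) : thompsonGroup ≤ Γ := by
  intro f hf
  obtain ⟨γ₀, hγ₀, h₀⟩ := exists_apply_eq_zero hΓ (thompsonLift.isDyadic_zero hf)
  set g := γ₀ * f with hg
  have hgT : g ∈ thompsonGroup := mul_mem (hle hγ₀) hf
  have hg0 : g 0 = 0 := h₀
  have hlen : ∀ a, 0 < (⟨a, m₀⟩ : DyArc).len := fun a => DyArc.len_pos _
  have hlen2 : ∀ a, (⟨a, m₀⟩ : DyArc).len ≤ 1 / 2 := fun a => DyArc.len_le_half _ hm₀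
  -- straighten the germ of `g` on the right of `0`
  let R : DyArc := ⟨0, m₀⟩
  have hR := hΓ R ⟨0, 0, by simp [R]⟩ le_rfl
  have hRs : ∀ x, 0 ≤ x → x ≤ R.len / 2 → rot R (1 * x) = 1 * (x / 2) := by
    intro x h0 h1
    rw [one_mul, rot_low R (by simpa [R]) (by simp only [R] at *; linarith)]
    simp [R]
  obtain ⟨η, hη, a, hga⟩ := exists_germ_right hgT hg0
  obtain ⟨k, η₁, hη₁, h₁⟩ := exists_zpow_straighten (half_pos R.len_pos) hη hRs hga
  have hkfix : ∀ x, -(1 / 2) ≤ x → x ≤ 0 → (rot R ^ k) x = x := by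
    intro x hx0 hx1
    refine zpow_apply_of_apply_eq ?_ k
    exact rot_out R 1 (by have := hlen2 0; simp only [R] at *; push_cast; linarith)
      (by simp only [R]; push_cast; linarith)
  -- straighten the germ on the left of `0`
  obtain ⟨η₂, hη₂, b, hgb⟩ := exists_germ_left hgT hg0
  let L : DyArc := ⟨-R.len, m₀⟩
  have hLR : L.len = R.len := rfl
  have hLl : L.left = -R.len := rfl
  have hL := hΓ L (R.isDyadic_len).neg le_rfl
  have hLs : ∀ x, 0 ≤ x → x ≤ R.len / 2 → (rot L)⁻¹ (-1 * x) = -1 * (x / 2) := by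
    intro x h0 h1
    apply (rot L).injective
    rw [← Homeomorph.mul_apply, mul_inv_cancel, Homeomorph.one_apply,
      rot_high L (by rw [hLl, hLR]; linarith) (by rw [hLl, hLR]; linarith), hLl, hLR]
    ring
  have hgb' : ∀ x, 0 ≤ x → x ≤ min η₂ (1 / 2 / 2 ^ b) →
      (rot R ^ k * g) (-1 * x) = -1 * (2 ^ b * x) := by
    intro x h0 h1
    have h2 := h1.trans (min_le_right _ _)
    rw [le_div_iff₀ (by positivity)] at h2
    rw [Homeomorph.mul_apply, hgb x h0 (h1.trans (min_le_left _ _)), hkfix]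
    · linarith
    · have : 0 ≤ (2 : ℝ) ^ b * x := mul_nonneg (by positivity) h0
      linarith
  obtain ⟨l, η₃, hη₃, h₃⟩ := exists_zpow_straighten (half_pos R.len_pos)
    (lt_min hη₂ (by positivity)) hLs hgb'
  have hlfix : ∀ x, 0 ≤ x → x ≤ 1 / 2 → ((rot L)⁻¹ ^ l) x = x := by
    intro x hx0 hx1
    rw [inv_zpow']
    refine zpow_apply_of_apply_eq ?_ (-l)
    exact rot_out L 0 (by rw [hLl, hLR]; push_cast; linarith)
      (by have := hlen2 0; rw [hLl]; simp only [R]; push_cast; linarith)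
  set h := (rot L)⁻¹ ^ l * (rot R ^ k * g) with hh
  have hhT : h ∈ thompsonGroup := mul_mem (zpow_mem (inv_mem (hle hL)) l)
    (mul_mem (zpow_mem (hle hR) k) hgT)
  -- `h` is the identity near `0`, hence supported in `[t, 1 - t] + ℤ` for some small `t`
  obtain ⟨m, hm, hmη⟩ : ∃ m : ℕ, m₀ ≤ m ∧ (2 ^ m : ℝ)⁻¹ < min (min η₁ η₃) (1 / 2) := by
    have h1 : Tendsto (fun m : ℕ => ((2 : ℝ) ^ m)⁻¹) atTop (𝓝 0) := by
      simpa using tendsto_pow_atTop_nhds_zero_of_lt_one (r := (2⁻¹ : ℝ)) (by norm_num) (by norm_num)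
    obtain ⟨m, h2, h3⟩ := ((h1.eventually_lt_const (lt_min (lt_min hη₁ hη₃) one_half_pos)).and (eventually_ge_atTop m₀)).exists
    exact ⟨m, h3, h2⟩
  have hhfix : ∀ x, -(2 ^ m : ℝ)⁻¹ ≤ x → x ≤ (2 ^ m : ℝ)⁻¹ → h x = x := by
    intro x hx0 hx1
    have m1 : (2 ^ m : ℝ)⁻¹ < η₁ := hmη.trans_le ((min_le_left _ _).trans (min_le_left _ _))
    have m2 : (2 ^ m : ℝ)⁻¹ < η₃ := hmη.trans_le ((min_le_left _ _).trans (min_le_right _ _))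
    have m3 : (2 ^ m : ℝ)⁻¹ < 1 / 2 := hmη.trans_le (min_le_right _ _)
    rcases le_total 0 x with hx | hx
    · have := h₁ x hx (by linarith)
      simp only [one_mul] at this
      rw [hh, Homeomorph.mul_apply, Homeomorph.mul_apply, this, hlfix x hx (by linarith)]
    · have := h₃ (-x) (by linarith) (by linarith)
      simp only [mul_neg, neg_mul, one_mul, neg_neg] at this
      rw [hh, Homeomorph.mul_apply, this]
  -- with `t` a quarter of the length of `E`, the support `[t, 1 - t]` is `[E.left, E.left + j * t]` for
  -- `j = 2 ^ (m + 2) - 2`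
  let E : DyArc := ⟨(2 ^ (m + 2))⁻¹, m⟩
  have hE4 : E.len / 4 = (2 ^ (m + 2))⁻¹ := by
    simp only [E, DyArc.len]; rw [pow_add]; norm_num; field_simp
  have hmem : h ∈ Γ := by
    have hp : (2 : ℕ) ≤ 2 ^ (m + 2) := by
      rw [pow_add]; have := Nat.one_le_two_pow (n := m); omega
    refine mem_of_support hΓ (E := E) (isDyadic_inv_two_pow _) hm (2 ^ (m + 2) - 2) ?_ hhT
      fun x h0 h1 => ?_
    · rw [hE4]; push_cast [hp]; rw [sub_add_cancel, mul_inv_cancel₀ (by positivity)]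
    · rw [hE4] at h0
      have hEl : E.left = (2 ^ (m + 2))⁻¹ := rfl
      have h4 : ((2 : ℝ) ^ (m + 2))⁻¹ ≤ (2 ^ m)⁻¹ := by
        gcongr
        · norm_num
        · omega
      push_cast [hp] at h0
      have h5 : ((2 : ℝ) ^ (m + 2) - 2) * (2 ^ (m + 2))⁻¹ = 1 - 2 * (2 ^ (m + 2))⁻¹ := by
        field_simp
      rw [h5, hEl] at h0
      rw [hEl] at h1
      have := hhfix (x - 1) (by linarith) (by linarith)
      have h6 := hhT.2.1 (x - 1)
      rw [sub_add_cancel] at h6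
      linarith
  have e : f = γ₀⁻¹ * ((rot R ^ k)⁻¹ * (((rot L)⁻¹ ^ l)⁻¹ * h)) := by
    rw [hh, hg]; group
  rw [e]
  exact mul_mem (inv_mem hγ₀) (mul_mem (inv_mem (zpow_mem hR k))
    (mul_mem (inv_mem (zpow_mem (inv_mem hL) l)) hmem))

end Generation

/-- The element `rot D`, as an element of Thompson's group. -/
noncomputable def rotT (D : DyArc) (hD : IsDyadic D.left) : thompsonGroup := ⟨rot D, rot_mem hD⟩

/-- Thompson's group is generated by the basic elements supported in arbitrarily short intervals. -/
theorem eq_top_of_rot_mem {S : Subgroup thompsonGroup} (m₀ : ℕ)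
    (hS : ∀ (D : DyArc) (hD : IsDyadic D.left), m₀ ≤ D.level → rotT D hD ∈ S) : S = ⊤ := by
  have : thompsonGroup ≤ S.map thompsonGroup.subtype := by
    refine thompsonGroup_le_of_le (m₀ := m₀ + 1) ?_ (by omega) fun D hD hm =>
      ⟨_, hS D hD (by omega), rfl⟩
    rintro _ ⟨x, -, rfl⟩
    exact x.2
  refine (Subgroup.eq_top_iff' S).2 fun x => ?_
  obtain ⟨y, hy, hyx⟩ := this x.2
  rwa [← Subtype.ext hyx]

/-- Conjugation by `rot E` and by `rot` of the right half of `E` shortens every word of length at least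
three: words beginning with `00` or `11` directly, those with `10` or `01` after first being conjugated
to such words or to one another. -/
theorem rot_mem_of_length_le_two {Γ : Subgroup (ℝ ≃ₜ ℝ)} {E : DyArc}
    (h : ∀ w : List Bool, w.length ≤ 2 → rot (E.sub w) ∈ Γ) (w : List Bool) : rot (E.sub w) ∈ Γ := by
  induction hn : w.length using Nat.strong_induction_on generalizing w with
  | _ n ih =>
  have hX : rot E ∈ Γ := h [] (by simp)
  have hX1 : rot (E.child true) ∈ Γ := h [true] (by simp)
  have hconj : ∀ {x y z : ℝ ≃ₜ ℝ}, x * y = z * x → x ∈ Γ → y ∈ Γ → z ∈ Γ := by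
    intro x y z e hx hy
    rw [show z = x * y * x⁻¹ by rw [e]; group]
    exact mul_mem (mul_mem hx hy) (inv_mem hx)
  have hconj' : ∀ {x y z : ℝ ≃ₜ ℝ}, x * y = z * x → x ∈ Γ → z ∈ Γ → y ∈ Γ := by
    intro x y z e hx hz
    rw [show y = x⁻¹ * (z * x) by rw [← e]; group]
    exact mul_mem (inv_mem hx) (mul_mem hz hx)
  have h11 : ∀ u, (true :: true :: u).length ≤ n → rot (E.sub (true :: true :: u)) ∈ Γ :=
    fun u hu => hconj' (rot_conj_high E u) hX (ih (u.length + 1) (by simp at hu; omega) (true :: u) rfl)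
  have h10 : ∀ u, 3 ≤ (true :: false :: u).length → (true :: false :: u).length ≤ n →
      rot (E.sub (true :: false :: u)) ∈ Γ := by
    rintro (- | ⟨- | -, u⟩) h3 hu
    · simp at h3
    · exact hconj (rot_conj_low (E.child true) u) hX1 (ih (u.length + 2) (by simp at hu; omega)
        (true :: false :: u) (by simp))
    · exact hconj (rot_conj_mid (E.child true) u) hX1 (h11 (false :: u) (by simpa using hu))
  by_cases h3 : w.length ≤ 2
  · exact h w h3
  rcases w with - | ⟨- | -, - | ⟨- | -, u⟩⟩
  · simp at h3
  · simp at h3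
  · exact hconj (rot_conj_low E u) hX (ih (u.length + 1) (by rw [← hn]; simp) (false :: u) rfl)
  · exact hconj (rot_conj_mid E u) hX (h10 u (by simpa [Nat.one_le_iff_ne_zero, Nat.pos_iff_ne_zero] using Nat.lt_of_not_le h3)
      (by simpa using hn.le))
  · simp at h3
  · exact h10 u (Nat.lt_of_not_le h3) hn.le
  · exact h11 u hn.le

/-- The lift of Thompson's group `T` is finitely generated. -/
theorem exists_finite_closure_eq : ∃ F : Set (ℝ ≃ₜ ℝ), F.Finite ∧
    Subgroup.closure F = thompsonGroup := by
  let E : ℕ → DyArc := fun j => ⟨(j : ℝ) / 4, 1⟩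
  have hE : ∀ j, IsDyadic (E j).left := fun j => ⟨j, 2, by norm_num [E]⟩
  have hlen : ∀ j, (E j).len = 1 / 2 := fun j => by simp [E, DyArc.len]
  let F : Set (ℝ ≃ₜ ℝ) :=
    (fun p : ℕ × List Bool => rot ((E p.1).sub p.2)) '' (Iio 4 ×ˢ {w | w.length ≤ 2})
  have hsub : F ⊆ thompsonGroup := by
    rintro _ ⟨⟨j, w⟩, -, rfl⟩
    exact rot_mem ((E j).isDyadic_sub (hE j) w)
  refine ⟨F, ((finite_Iio 4).prod (List.finite_length_le Bool 2)).image _,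
    le_antisymm ((Subgroup.closure_le _).2 hsub) ?_⟩
  refine thompsonGroup_le_of_le (m₀ := 2) ((Subgroup.closure_le _).2 hsub) (by norm_num)
    fun D hD hm => ?_
  have hDlen : D.len ≤ 1 / 4 := by
    obtain ⟨t, ht⟩ := Nat.exists_eq_add_of_le hm
    rw [DyArc.len, ht, pow_add, mul_inv]
    have : ((2 : ℝ) ^ t)⁻¹ ≤ 1 := inv_le_one_of_one_le₀ (one_le_pow₀ (by norm_num))
    norm_num
    linarith
  -- up to an integer translation, `D` lies in one of the four intervals
  obtain ⟨k, v, hv0, hv1, hv⟩ := exists_floor_add 0 D.left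
  obtain ⟨j, hj⟩ : ∃ j : ℕ, j = ⌊v * 4⌋₊ := ⟨_, rfl⟩
  have hj0 : (j : ℝ) ≤ v * 4 := by rw [hj]; exact Nat.floor_le (by linarith)
  have hj1 : v * 4 < j + 1 := by rw [hj]; exact Nat.lt_floor_add_one _
  have hj4 : j < 4 := by
    have : (j : ℝ) < 4 := by linarith
    exact_mod_cast this
  have hle : treeGroup (E j) ≤ Subgroup.closure F := by
    rw [treeGroup, Subgroup.closure_le]
    rintro _ ⟨w, rfl⟩
    exact rot_mem_of_length_le_two (fun w hw => Subgroup.subset_closure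
      (show rot ((E j).sub w) ∈ F from ⟨(j, w), Set.mk_mem_prod hj4 hw, rfl⟩)) w
  refine hle (mem_treeGroup (rot_mem hD) (hE j) fun x h0 h1 => ?_)
  rw [hlen] at h0
  have hl : (E j).left = (j : ℝ) / 4 := rfl
  rw [hl] at h0 h1
  exact rot_out D k (by linarith) (by linarith)

theorem rotT_mem_of_shift {S : Subgroup thompsonGroup} [hn : S.Normal] {a a' : ℝ} {m : ℕ}
    (ha : IsDyadic a) (ha' : IsDyadic a') (h : rotT ⟨a, m⟩ ha ∈ S) : rotT ⟨a', m⟩ ha' ∈ S := by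
  let g : thompsonGroup := ⟨Homeomorph.addRight (a' - a), shift_mem (ha'.sub ha)⟩
  have haff : AffOn (g : ℝ ≃ₜ ℝ) ⟨a, m⟩ ⟨a', m⟩ := by
    intro u _
    simp only [g, Homeomorph.coe_addRight, DyArc.len]
    ring
  have e := haff.conj g.2.1 g.2.2.1
  have : rotT ⟨a', m⟩ ha' = g * rotT ⟨a, m⟩ ha * g⁻¹ := by
    rw [eq_mul_inv_iff_mul_eq]; exact Subtype.ext e.symm
  rw [this]
  exact hn.conj_mem _ h g

theorem isDyadic_zero : IsDyadic 0 := ⟨0, 0, by simp⟩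

theorem rotT_mem_level_iff {S : Subgroup thompsonGroup} [hn : S.Normal] (m : ℕ) :
    rotT ⟨0, m + 1⟩ isDyadic_zero ∈ S ↔ rotT ⟨0, m + 2⟩ isDyadic_zero ∈ S := by
  let g : thompsonGroup := rotT ⟨0, m⟩ isDyadic_zero
  have e := rot_conj_low ⟨0, m⟩ []
  have : rotT ⟨0, m + 2⟩ isDyadic_zero = g * rotT ⟨0, m + 1⟩ isDyadic_zero * g⁻¹ := by
    rw [eq_mul_inv_iff_mul_eq]; exact Subtype.ext e.symm
  rw [this]
  refine ⟨fun h => hn.conj_mem _ h g, fun h => ?_⟩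
  simpa [mul_assoc] using hn.conj_mem _ h g⁻¹

/-- A normal subgroup of Thompson's group that contains one basic element is the whole group. -/
theorem eq_top_of_normal {S : Subgroup thompsonGroup} [hn : S.Normal] {D : DyArc}
    (hD : IsDyadic D.left) (hm : 1 ≤ D.level) (h : rotT D hD ∈ S) : S = ⊤ := by
  have h0 : ∀ m, rotT ⟨0, m + 1⟩ isDyadic_zero ∈ S ↔ rotT ⟨0, 1⟩ isDyadic_zero ∈ S := by
    intro m
    induction m with
    | zero => rfl
    | succ m ih => rw [← rotT_mem_level_iff, ih]
  obtain ⟨a, m⟩ := D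
  obtain ⟨m, rfl⟩ := Nat.exists_eq_add_of_le' hm
  have h1 := (h0 m).1 (rotT_mem_of_shift hD isDyadic_zero h)
  refine eq_top_of_rot_mem 1 ?_
  rintro ⟨b, k⟩ hE hk
  obtain ⟨k, rfl⟩ := Nat.exists_eq_add_of_le' hk
  exact rotT_mem_of_shift isDyadic_zero hE ((h0 k).2 h1)

/-! ### The action on the plane and on the torus -/

theorem exists_int_add_int_div_near {lam : ℝ} (hirr : Irrational lam) (z : ℝ) {ε : ℝ} (hε : 0 < ε) :
    ∃ m n : ℤ, |(m + n / lam) - z| < ε := by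
  have hd : Dense (AddSubgroup.closure {1, lam⁻¹} : Set ℝ) := by
    rw [dense_addSubgroupClosure_pair_iff]
    simpa using hirr
  obtain ⟨y, hy, hyS⟩ := hd.exists_dist_lt z hε
  obtain ⟨m, n, h⟩ := AddSubgroup.mem_closure_pair.1 hy
  refine ⟨m, n, ?_⟩
  rw [← Real.dist_eq, dist_comm]
  convert hyS using 2
  rw [← h]
  simp [div_eq_mul_inv]

theorem exists_isDyadic_near (z : ℝ) {ε : ℝ} (hε : 0 < ε) : ∃ d, IsDyadic d ∧ |d - z| < ε := by
  obtain ⟨m, hm⟩ := exists_pow_lt_of_lt_one hε (by norm_num : (1 / 2 : ℝ) < 1)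
  obtain ⟨i, u, hu0, hu1, hz⟩ := floor_cell z m
  refine ⟨i / 2 ^ m, ⟨i, m, rfl⟩, ?_⟩
  rw [hz, abs_sub_comm, ← sub_div, add_sub_cancel_left, abs_of_nonneg (by positivity)]
  calc u / 2 ^ m ≤ 1 / 2 ^ m := by gcongr
    _ < ε := by simpa using hm

section Plane

variable {lam : ℝ}

/-- The homeomorphisms of the plane that commute with the translations by `ℤ²` and preserve each
line of slope `lam`. -/
def leafGroup (lam : ℝ) : Subgroup ((ℝ × ℝ) ≃ₜ (ℝ × ℝ)) where
  carrier := {F | (∀ (p : ℝ × ℝ) (m n : ℤ), F (p + ((m : ℝ), (n : ℝ))) = F p + ((m : ℝ), (n : ℝ))) ∧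
    ∀ p, (F p).2 - lam * (F p).1 = p.2 - lam * p.1}
  mul_mem' := by
    rintro F G ⟨h1, h2⟩ ⟨h3, h4⟩
    exact ⟨fun p m n => by simp only [Homeomorph.mul_apply, h3, h1],
      fun p => by simp only [Homeomorph.mul_apply, h2, h4]⟩
  one_mem' := ⟨fun _ _ _ => rfl, fun _ => rfl⟩
  inv_mem' := by
    rintro F ⟨h1, h2⟩
    have hr : ∀ p, F (F⁻¹ p) = p := F.apply_symm_apply
    refine ⟨fun p m n => ?_, fun p => ?_⟩
    · apply F.injective
      rw [hr, h1, hr]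
    · rw [← h2, hr]

theorem leafGroup_image {F : (ℝ × ℝ) ≃ₜ (ℝ × ℝ)} (hF : F ∈ leafGroup lam) (c : ℝ) :
    F '' slopeLeaf lam c = slopeLeaf lam c := by
  have key : ∀ G ∈ leafGroup lam, ∀ p ∈ slopeLeaf lam c, G p ∈ slopeLeaf lam c := by
    intro G hG p hp
    have h1 := hG.2 p
    simp only [slopeLeaf, mem_ofPred_eq] at hp ⊢
    linarith
  refine Subset.antisymm (image_subset_iff.2 (key F hF)) fun p hp => ?_
  exact ⟨F⁻¹ p, key _ (inv_mem hF) p hp, F.apply_symm_apply p⟩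

theorem leafGroup_apply_leaf (hl : lam ≠ 0) {F : (ℝ × ℝ) ≃ₜ (ℝ × ℝ)} (hF : F ∈ leafGroup lam)
    (t : ℝ) : F (t / lam, t) = ((F (t / lam, t)).2 / lam, (F (t / lam, t)).2) := by
  have h := hF.2 (t / lam, t)
  simp only [mul_div_cancel₀ t hl, sub_self] at h
  ext
  · simp only; rw [eq_div_iff hl]; linarith
  · rfl

/-- The action on the line of slope `lam` through the origin, parametrized by the second
coordinate. -/
noncomputable def leafRestrict (hl : lam ≠ 0) : leafGroup lam →* (ℝ ≃ₜ ℝ) where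
  toFun F :=
    { toFun := fun t => ((F : (ℝ × ℝ) ≃ₜ (ℝ × ℝ)) (t / lam, t)).2
      invFun := fun t => ((F⁻¹ : (ℝ × ℝ) ≃ₜ (ℝ × ℝ)) (t / lam, t)).2
      left_inv := fun t => by
        beta_reduce
        rw [← leafGroup_apply_leaf hl F.2, ← Homeomorph.mul_apply, inv_mul_cancel,
          Homeomorph.one_apply]
      right_inv := fun t => by
        beta_reduce
        rw [← leafGroup_apply_leaf hl (inv_mem F.2), ← Homeomorph.mul_apply, mul_inv_cancel,
          Homeomorph.one_apply]
      continuous_toFun := by fun_prop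
      continuous_invFun := by fun_prop }
  map_one' := by ext t; rfl
  map_mul' F G := by
    ext t
    show ((F : (ℝ × ℝ) ≃ₜ (ℝ × ℝ)) ((G : (ℝ × ℝ) ≃ₜ (ℝ × ℝ)) (t / lam, t))).2 = _
    rw [leafGroup_apply_leaf hl G.2]
    rfl

theorem leafRestrict_apply (hl : lam ≠ 0) (F : leafGroup lam) (t : ℝ) :
    (F : (ℝ × ℝ) ≃ₜ (ℝ × ℝ)) (t / lam, t) = (leafRestrict hl F t / lam, leafRestrict hl F t) :=
  leafGroup_apply_leaf hl F.2 t

/-- The translates by `ℤ²` of the line of irrational slope through the origin are dense, so an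
element of `leafGroup` is determined by its action on this line. -/
theorem leafRestrict_injective (hirr : Irrational lam) (hl : lam ≠ 0) :
    Function.Injective (leafRestrict hl) := by
  rw [injective_iff_map_eq_one]
  intro F hF
  apply Subtype.ext
  ext1 p
  have hcl : IsClosed {p | (F : (ℝ × ℝ) ≃ₜ (ℝ × ℝ)) p = p} :=
    isClosed_eq (F : (ℝ × ℝ) ≃ₜ (ℝ × ℝ)).continuous continuous_id
  suffices h : p ∈ closure {p | (F : (ℝ × ℝ) ≃ₜ (ℝ × ℝ)) p = p} from hcl.closure_subset h
  rw [Metric.mem_closure_iff]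
  intro ε hε
  obtain ⟨m, n, hmn⟩ := exists_int_add_int_div_near hirr (p.1 - p.2 / lam) hε
  refine ⟨((p.2 + n) / lam, p.2 + n) + ((m : ℝ), ((-n : ℤ) : ℝ)), ?_, ?_⟩
  · rw [mem_ofPred_eq, F.2.1, leafRestrict_apply hl, hF]
    rfl
  · rw [Prod.dist_eq, max_lt_iff, dist_comm, Real.dist_eq, dist_comm, Real.dist_eq]
    constructor
    · refine lt_of_eq_of_lt (congrArg abs ?_) hmn
      simp only [Prod.fst_add]
      ring
    · simpa using hε

/-- The extension to the plane of a homeomorphism of the line that commutes with the translation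
by `1`: the second coordinate is moved by the homeomorphism, and the first is adjusted so as to stay
on the line of slope `lam`. -/
noncomputable def verticalLift (lam : ℝ) (g : ℝ ≃ₜ ℝ) : (ℝ × ℝ) ≃ₜ (ℝ × ℝ) where
  toFun p := (p.1 + (g p.2 - p.2) / lam, g p.2)
  invFun p := (p.1 + (g.symm p.2 - p.2) / lam, g.symm p.2)
  left_inv p := by ext <;> simp; ring
  right_inv p := by ext <;> simp; ring
  continuous_toFun := by fun_prop
  continuous_invFun := by fun_prop

/-- The analogue of `verticalLift` for the first coordinate. -/
noncomputable def horizontalLift (lam : ℝ) (g : ℝ ≃ₜ ℝ) : (ℝ × ℝ) ≃ₜ (ℝ × ℝ) where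
  toFun p := (g p.1, p.2 + lam * (g p.1 - p.1))
  invFun p := (g.symm p.1, p.2 + lam * (g.symm p.1 - p.1))
  left_inv p := by ext <;> simp; ring
  right_inv p := by ext <;> simp; ring
  continuous_toFun := by fun_prop
  continuous_invFun := by fun_prop

theorem verticalLift_mem (hl : lam ≠ 0) {g : ℝ ≃ₜ ℝ} (hg : ∀ x, g (x + 1) = g x + 1) :
    verticalLift lam g ∈ leafGroup lam := by
  refine ⟨fun p m n => ?_, fun p => ?_⟩
  · simp only [verticalLift, Homeomorph.homeomorph_mk_coe, Equiv.coe_fn_mk, Prod.fst_add,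
      Prod.snd_add, periodic_add_int hg]
    ext <;> simp
    ring
  · simp only [verticalLift, Homeomorph.homeomorph_mk_coe, Equiv.coe_fn_mk]
    field_simp
    ring

theorem horizontalLift_mem {g : ℝ ≃ₜ ℝ} (hg : ∀ x, g (x + 1) = g x + 1) :
    horizontalLift lam g ∈ leafGroup lam := by
  refine ⟨fun p m n => ?_, fun p => ?_⟩
  · simp only [horizontalLift, Homeomorph.homeomorph_mk_coe, Equiv.coe_fn_mk, Prod.fst_add,
      Prod.snd_add, periodic_add_int hg]
    ext <;> simp
    ring
  · simp only [horizontalLift, Homeomorph.homeomorph_mk_coe, Equiv.coe_fn_mk]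
    ring

theorem GLambda_le_range (hl : lam ≠ 0) : GLambda lam ≤ (leafRestrict hl).range := by
  rw [GLambda, Subgroup.closure_le]
  rintro f (hf | ⟨g, hg, hfg⟩)
  · refine ⟨⟨verticalLift lam f, verticalLift_mem hl hf.2.1⟩, ?_⟩
    ext t
    rfl
  · refine ⟨⟨horizontalLift lam g, horizontalLift_mem hg.2.1⟩, ?_⟩
    ext t
    show t + lam * (g (t / lam) - t / lam) = f t
    conv_rhs => rw [← mul_div_cancel₀ t hl, hfg]
    field_simp
    ring

/-- The action on the plane that extends the action on the line. -/
noncomputable def planeAction (hirr : Irrational lam) (hl : lam ≠ 0) :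
    GLambda lam →* leafGroup lam :=
  (MonoidHom.ofInjective (leafRestrict_injective hirr hl)).symm.toMonoidHom.comp
    (Subgroup.inclusion (GLambda_le_range hl))

theorem leafRestrict_planeAction (hirr : Irrational lam) (hl : lam ≠ 0) (g : GLambda lam) :
    leafRestrict hl (planeAction hirr hl g) = g := by
  have := MonoidHom.apply_ofInjective_symm (leafRestrict_injective hirr hl)
    (Subgroup.inclusion (GLambda_le_range hl) g)
  exact this

theorem isQuotientMap_torusProj : IsQuotientMap torusProj :=
  ((QuotientAddGroup.isOpenQuotientMap_mk (G := ℝ)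
    (N := AddSubgroup.zmultiples (1 : ℝ))).prodMap (QuotientAddGroup.isOpenQuotientMap_mk (G := ℝ)
    (N := AddSubgroup.zmultiples (1 : ℝ)))).isQuotientMap

theorem torusProj_eq_iff {p q : ℝ × ℝ} :
    torusProj p = torusProj q ↔ ∃ m n : ℤ, q = p + ((m : ℝ), (n : ℝ)) := by
  have h1 : ∀ x y : ℝ, (x : UnitAddCircle) = y ↔ ∃ m : ℤ, y = x + m := by
    intro x y
    rw [QuotientAddGroup.eq, AddSubgroup.mem_zmultiples_iff]
    refine exists_congr fun m => ?_
    simp only [zsmul_eq_mul, mul_one]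
    constructor <;> intro h <;> linarith
  simp only [torusProj, h1, Prod.ext_iff, Prod.fst_add, Prod.snd_add]
  constructor
  · rintro ⟨⟨m, hm⟩, n, hn⟩; exact ⟨m, n, hm, hn⟩
  · rintro ⟨m, n, hm, hn⟩; exact ⟨⟨m, hm⟩, n, hn⟩

theorem torusProj_congr {F : (ℝ × ℝ) ≃ₜ (ℝ × ℝ)} (hF : F ∈ leafGroup lam) {p q : ℝ × ℝ}
    (h : torusProj p = torusProj q) : torusProj (F p) = torusProj (F q) := by
  obtain ⟨m, n, rfl⟩ := torusProj_eq_iff.1 h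
  exact torusProj_eq_iff.2 ⟨m, n, hF.1 p m n⟩

theorem torusProj_surjInv (z : Torus) :
    torusProj (Function.surjInv isQuotientMap_torusProj.surjective z) = z :=
  Function.surjInv_eq _ z

/-- The map of the torus induced by an element of `leafGroup`. -/
noncomputable def leafTorusMap (F : leafGroup lam) (z : Torus) : Torus :=
  torusProj ((F : (ℝ × ℝ) ≃ₜ (ℝ × ℝ)) (Function.surjInv isQuotientMap_torusProj.surjective z))

theorem leafTorusMap_torusProj (F : leafGroup lam) (p : ℝ × ℝ) :
    leafTorusMap F (torusProj p) = torusProj ((F : (ℝ × ℝ) ≃ₜ (ℝ × ℝ)) p) :=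
  torusProj_congr F.2 (torusProj_surjInv _)

theorem continuous_leafTorusMap (F : leafGroup lam) : Continuous (leafTorusMap F) := by
  rw [isQuotientMap_torusProj.continuous_iff]
  have : leafTorusMap F ∘ torusProj = torusProj ∘ (F : (ℝ × ℝ) ≃ₜ (ℝ × ℝ)) :=
    funext fun p => leafTorusMap_torusProj F p
  rw [this]
  exact isQuotientMap_torusProj.continuous.comp (Homeomorph.continuous _)

theorem leafTorusMap_mul (F G : leafGroup lam) (z : Torus) :
    leafTorusMap (F * G) z = leafTorusMap F (leafTorusMap G z) := by
  obtain ⟨p, rfl⟩ := isQuotientMap_torusProj.surjective z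
  rw [leafTorusMap_torusProj, leafTorusMap_torusProj, leafTorusMap_torusProj]
  rfl

theorem leafTorusMap_one (z : Torus) : leafTorusMap (1 : leafGroup lam) z = z := torusProj_surjInv z

/-- The action on the torus induced by the action on the plane. -/
noncomputable def torusHom : leafGroup lam →* (Torus ≃ₜ Torus) where
  toFun F :=
    { toFun := leafTorusMap F
      invFun := leafTorusMap F⁻¹
      left_inv := fun z => by rw [← leafTorusMap_mul, inv_mul_cancel, leafTorusMap_one]
      right_inv := fun z => by rw [← leafTorusMap_mul, mul_inv_cancel, leafTorusMap_one]
      continuous_toFun := continuous_leafTorusMap F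
      continuous_invFun := continuous_leafTorusMap F⁻¹ }
  map_one' := by ext1 z; exact leafTorusMap_one z
  map_mul' F G := by ext1 z; exact leafTorusMap_mul F G z

theorem planeAction_shift (hirr : Irrational lam) (hl : lam ≠ 0) {d : ℝ} {g : GLambda lam}
    (hg : ∀ x, (g : ℝ ≃ₜ ℝ) x = x + d) (p : ℝ × ℝ) :
    (planeAction hirr hl g : (ℝ × ℝ) ≃ₜ (ℝ × ℝ)) p = p + (d / lam, d) := by
  have hp : ∀ x, (g : ℝ ≃ₜ ℝ) (x + 1) = (g : ℝ ≃ₜ ℝ) x + 1 := fun x => by rw [hg, hg]; ring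
  have : planeAction hirr hl g = ⟨verticalLift lam g, verticalLift_mem hl hp⟩ := by
    apply leafRestrict_injective hirr hl
    rw [leafRestrict_planeAction]
    ext t
    rfl
  rw [this]
  ext <;> simp [verticalLift, hg]

theorem isMinimalAction_torus (hirr : Irrational lam) (hl : lam ≠ 0) :
    IsMinimalAction ((torusHom (lam := lam)).comp (planeAction hirr hl)) := by
  intro z
  obtain ⟨p, rfl⟩ := isQuotientMap_torusProj.surjective z
  rw [dense_iff_inter_open]
  rintro U hU ⟨w, hw⟩
  obtain ⟨q, rfl⟩ := isQuotientMap_torusProj.surjective w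
  obtain ⟨ε, hε, hball⟩ := Metric.isOpen_iff.1 (hU.preimage isQuotientMap_torusProj.continuous) q hw
  -- first adjust the second coordinate, then the first one by an integer translation of the line
  obtain ⟨d, hd, hdn⟩ := exists_isDyadic_near (q.2 - p.2) hε
  obtain ⟨m, n, hmn⟩ := exists_int_add_int_div_near hirr (q.1 - p.1 - d / lam) hε
  let g : GLambda lam := ⟨Homeomorph.addRight (d + n),
    Subgroup.subset_closure (Or.inl (shift_mem (hd.add (isDyadic_int n))))⟩
  refine ⟨torusProj (p + ((d + n) / lam, d + n)), ?_, g, ?_⟩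
  · rw [show torusProj (p + ((d + n) / lam, d + n)) =
      torusProj (p + ((d + n) / lam, d + n) + ((m : ℝ), ((-n : ℤ) : ℝ))) from
        torusProj_eq_iff.2 ⟨m, -n, rfl⟩]
    apply hball
    rw [Metric.mem_ball, Prod.dist_eq, max_lt_iff, Real.dist_eq, Real.dist_eq]
    constructor
    · refine lt_of_eq_of_lt (congrArg abs ?_) hmn
      simp only [Prod.fst_add]
      ring
    · refine lt_of_eq_of_lt (congrArg abs ?_) hdn
      simp only [Prod.snd_add]
      push_cast
      ring
  · show leafTorusMap _ _ = _
    rw [leafTorusMap_torusProj, planeAction_shift hirr hl (d := d + n) fun x => rfl]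

end Plane

/-! ### Elements with local support, and the pentagon relation -/

/-- `t` is within `ρ` of `c` modulo `ℤ`. -/
def Near (c ρ t : ℝ) : Prop := ∃ k : ℤ, |t - c - k| < ρ

theorem Near.mono {c ρ ρ' t : ℝ} (h : Near c ρ t) (hρ : ρ ≤ ρ') : Near c ρ' t := by
  obtain ⟨k, hk⟩ := h
  exact ⟨k, hk.trans_le hρ⟩

theorem Near.of_abs_sub_le {c ρ η t y : ℝ} (h : Near c ρ y) (hy : |y - t| ≤ η) :
    Near c (ρ + η) t := by
  obtain ⟨k, hk⟩ := h
  refine ⟨k, ?_⟩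
  rw [abs_lt] at *
  rw [abs_le] at hy
  constructor <;> linarith

theorem near_add_int {c ρ t : ℝ} (n : ℤ) : Near (c + n) ρ t ↔ Near c ρ t := by
  constructor
  · rintro ⟨k, hk⟩
    exact ⟨k + n, by push_cast; rwa [show t - c - (k + n) = t - (c + n) - k by ring]⟩
  · rintro ⟨k, hk⟩
    exact ⟨k - n, by push_cast; rwa [show t - (c + n) - (k - n) = t - c - k by ring]⟩

/-- Translation by `x` moves an interval off another one modulo `ℤ` if `x` is at least the sum of the
radii and not too close to `1`. -/
theorem Near.not_sub {c ρ ρ' t x : ℝ} (h : Near c ρ t) (h1 : ρ + ρ' ≤ x) (h2 : x + ρ + ρ' ≤ 1) :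
    ¬ Near c ρ' (t - x) := by
  rintro ⟨l, hl⟩
  obtain ⟨k, hk⟩ := h
  rw [abs_lt] at hk hl
  have h3 : k - l < 1 := by
    have : ((k - l : ℤ) : ℝ) < 1 := by push_cast; linarith
    exact_mod_cast this
  have h4 : 0 < k - l := by
    have : (0 : ℝ) < ((k - l : ℤ) : ℝ) := by push_cast; linarith
    exact_mod_cast this
  omega

theorem homeo_inv_apply_self (f : ℝ ≃ₜ ℝ) (x : ℝ) : f⁻¹ (f x) = x := f.symm_apply_apply x

theorem homeo_apply_inv_self (f : ℝ ≃ₜ ℝ) (x : ℝ) : f (f⁻¹ x) = x := f.apply_symm_apply x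

theorem homeo_inv_fix {f : ℝ ≃ₜ ℝ} {x : ℝ} (h : f x = x) : f⁻¹ x = x := by
  conv_lhs => rw [← h]
  exact homeo_inv_apply_self f x

theorem commute_of_disjoint {f g : ℝ ≃ₜ ℝ} (h : ∀ t, f t = t ∨ g t = t) : Commute f g := by
  have key : ∀ {f g : ℝ ≃ₜ ℝ}, (∀ t, f t = t ∨ g t = t) → ∀ t, f t ≠ t → f (g t) = g (f t) := by
    intro f g h t ht
    rw [(h t).resolve_left ht, (h (f t)).resolve_left fun h' => ht (f.injective h')]
  ext t
  show f (g t) = g (f t)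
  by_cases hf : f t = t
  · by_cases hg : g t = t
    · rw [hg, hf, hg]
    · exact (key (fun t => (h t).symm) t hg).symm
  · exact key h t hf

/-- The elements of Thompson's group supported within `ρ` of `c` modulo `ℤ`. -/
def localGroup (c ρ : ℝ) : Subgroup thompsonGroup where
  carrier := {g | ∀ t, ¬ Near c ρ t → (g : ℝ ≃ₜ ℝ) t = t}
  mul_mem' {a b} ha hb t ht := by
    show (a : ℝ ≃ₜ ℝ) ((b : ℝ ≃ₜ ℝ) t) = t
    rw [hb t ht, ha t ht]
  one_mem' _ _ := rfl
  inv_mem' {a} ha t ht := homeo_inv_fix (ha t ht)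

theorem localGroup_add_int (c ρ : ℝ) (n : ℤ) : localGroup (c + n) ρ = localGroup c ρ := by
  ext g
  show (∀ t, _) ↔ (∀ t, _)
  simp only [near_add_int]

/-- The elements of `localGroup c ρ` preserve each interval of radius `ρ` around `c + k`, as they fix its
endpoints. -/
theorem abs_apply_sub_le {c ρ : ℝ} (hρ : ρ ≤ 1 / 2) {g : thompsonGroup} (hg : g ∈ localGroup c ρ)
    (t : ℝ) (hρ0 : 0 ≤ ρ) : |(g : ℝ ≃ₜ ℝ) t - t| ≤ 2 * ρ := by
  by_cases ht : Near c ρ t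
  · obtain ⟨k, hk⟩ := ht
    have hfix : ∀ e : ℝ, |e| = ρ → (g : ℝ ≃ₜ ℝ) (c + k + e) = c + k + e := by
      intro e he
      refine hg _ ?_
      rintro ⟨l, hl⟩
      rw [show c + k + e - c - l = e + ((k - l : ℤ) : ℝ) by push_cast; ring] at hl
      have h1 : |((k - l : ℤ) : ℝ)| < 1 := by
        rw [abs_lt] at *
        have := abs_le.1 he.le
        constructor <;> linarith
      rw [← Int.cast_abs] at h1
      have h2 : |k - l| < 1 := by exact_mod_cast h1
      rw [Int.abs_lt_one_iff.1 h2, Int.cast_zero, add_zero, he] at hl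
      exact lt_irrefl _ hl
    have h1 := hfix ρ (abs_of_nonneg hρ0)
    have h2 := hfix (-ρ) (by rw [abs_neg, abs_of_nonneg hρ0])
    rw [abs_lt] at hk
    have h3 := g.2.1.monotone (show t ≤ c + k + ρ by linarith)
    have h4 := g.2.1.monotone (show c + k + -ρ ≤ t by linarith)
    rw [h1] at h3
    rw [h2] at h4
    rw [abs_le]
    constructor <;> linarith
  · rw [hg t ht]
    simpa using hρ0

theorem rotT_mem_localGroup {E : DyArc} (hE : IsDyadic E.left) {c ρ : ℝ}
    (h : |E.left - c| + E.len ≤ ρ) (w : List Bool) :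
    rotT (E.sub w) (E.isDyadic_sub hE w) ∈ localGroup c ρ := by
  intro t ht
  refine rot_out' _ fun k => ?_
  rintro ⟨h0, h1⟩
  refine ht ⟨-k, ?_⟩
  have h2 := E.left_le_sub w
  have h3 := E.right_sub_le w
  have := abs_le.1 (le_refl |E.left - c|)
  rw [abs_lt]
  push_cast
  constructor <;> linarith [E.len_pos]

theorem rotT_mem_localGroup_self {E : DyArc} (hE : IsDyadic E.left) {c ρ : ℝ}
    (h : |E.left - c| + E.len ≤ ρ) : rotT E hE ∈ localGroup c ρ :=
  rotT_mem_localGroup hE h []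

theorem exists_len_lt {ε : ℝ} (hε : 0 < ε) : ∃ m : ℕ, 1 ≤ m ∧ ∀ k, m ≤ k → (2 ^ k : ℝ)⁻¹ < ε := by
  obtain ⟨m, hm⟩ := exists_pow_lt_of_lt_one hε (by norm_num : (1 / 2 : ℝ) < 1)
  refine ⟨m + 1, by omega, fun k hk => lt_of_le_of_lt ?_ hm⟩
  rw [one_div, inv_pow]
  gcongr
  · norm_num
  · omega

section Pentagon

variable {A : Subgroup thompsonGroup} {K : Type*} [Group K] (φ : A →* K) {E : DyArc}
  (hE : IsDyadic E.left) (hA : ∀ w, rotT (E.sub w) (E.isDyadic_sub hE w) ∈ A)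

/-- The basic element attached to a subinterval of `E`, as an element of a subgroup. -/
noncomputable def rotIn (w : List Bool) : A := ⟨rotT (E.sub w) (E.isDyadic_sub hE w), hA w⟩

theorem rotIn_ext {w x y z : List Bool}
    (h : rot (E.sub w) * rot (E.sub x) = rot (E.sub y) * rot (E.sub z)) :
    rotIn hE hA w * rotIn hE hA x = rotIn hE hA y * rotIn hE hA z :=
  Subtype.ext (Subtype.ext h)

theorem rotIn_low (v u : List Bool) : rotIn hE hA v * rotIn hE hA (v ++ false :: u) =
    rotIn hE hA (v ++ false :: false :: u) * rotIn hE hA v := by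
  refine rotIn_ext hE hA ?_
  simp only [E.sub_append v]
  exact rot_conj_low _ u

theorem rotIn_mid (v u : List Bool) : rotIn hE hA v * rotIn hE hA (v ++ true :: false :: u) =
    rotIn hE hA (v ++ false :: true :: u) * rotIn hE hA v := by
  refine rotIn_ext hE hA ?_
  simp only [E.sub_append v]
  exact rot_conj_mid _ u

theorem rotIn_high (v u : List Bool) : rotIn hE hA v * rotIn hE hA (v ++ true :: true :: u) =
    rotIn hE hA (v ++ true :: u) * rotIn hE hA v := by
  refine rotIn_ext hE hA ?_
  simp only [E.sub_append v]
  exact rot_conj_high _ u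

theorem rotIn_pentagon (v : List Bool) : rotIn hE hA v * rotIn hE hA v =
    rotIn hE hA (v ++ [false]) * rotIn hE hA v * rotIn hE hA (v ++ [true]) := by
  refine Subtype.ext (Subtype.ext ?_)
  show rot (E.sub v) * rot (E.sub v) = rot (E.sub (v ++ [false])) * rot (E.sub v) *
    rot (E.sub (v ++ [true]))
  simp only [E.sub_append v]
  exact rot_pentagon _

/-- If the two conjugating elements in the pentagon argument commute with the elements they
conjugate, then the interior basic element dies. -/
theorem map_rotIn_eq_one (v : List Bool)
    (c1 : Commute (φ (rotIn hE hA v)) (φ (rotIn hE hA (v ++ [false, true]))))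
    (c2 : ∀ b, Commute (φ (rotIn hE hA (v ++ [false])))
      (φ (rotIn hE hA (v ++ [false, true, b])))) :
    φ (rotIn hE hA (v ++ [false, true])) = 1 := by
  have e1 := congrArg φ (rotIn_low hE hA v [true])
  have e2 := congrArg φ (rotIn_mid hE hA (v ++ [false]) [])
  have e3 := congrArg φ (rotIn_high hE hA (v ++ [false]) [])
  have e4 := congrArg φ (rotIn_pentagon hE hA (v ++ [false, true]))
  simp only [map_mul, List.append_assoc, List.cons_append, List.nil_append] at e1 e2 e3 e4
  exact eq_one_of_pentagon e1 e2 e3 e4 c1 (c2 false) (c2 true)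

/-- In the abelianization all elements commute, so interior basic elements are products of
commutators. -/
theorem rotIn_mem_commutator : rotIn hE hA [false, true] ∈ commutator A ∧
    rotIn hE hA [false, true, false] ∈ commutator A := by
  have h1 : Abelianization.of (rotIn hE hA [false, true]) = 1 :=
    map_rotIn_eq_one Abelianization.of hE hA [] (Commute.all _ _) fun _ => Commute.all _ _
  have e1 := congrArg Abelianization.of (rotIn_low hE hA [] [true])
  have e2 := congrArg Abelianization.of (rotIn_mid hE hA [false] [])
  simp only [map_mul, List.cons_append, List.nil_append] at e1 e2
  have h2 : Abelianization.of (rotIn hE hA [false, true, false]) = 1 := by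
    rw [h1, mul_one, right_eq_mul] at e1
    rwa [e1, one_mul, mul_eq_left] at e2
  rw [← Abelianization.ker_of]
  exact ⟨h1, h2⟩

end Pentagon

/-- Conjugation by `y` multiplies `x₁` and `x₂` by elements that are central for everything in sight, so
it does not change their commutator. -/
theorem commute_commutatorElement {Q : Type*} [Group Q] {x₁ x₂ y : Q}
    (h11 : Commute x₁ ⁅x₁, y⁆) (h12 : Commute x₁ ⁅x₂, y⁆) (h21 : Commute x₂ ⁅x₁, y⁆)
    (h22 : Commute x₂ ⁅x₂, y⁆) (hz : Commute ⁅x₁, y⁆ ⁅x₂, y⁆) : Commute ⁅x₁, x₂⁆ y := by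
  set u := ⁅x₁, y⁆⁻¹ with hu
  set w := ⁅x₂, y⁆⁻¹ with hw
  have e1 : y * x₁ * y⁻¹ = u * x₁ := by rw [hu, commutatorElement_def]; group
  have e2 : y * x₂ * y⁻¹ = w * x₂ := by rw [hw, commutatorElement_def]; group
  have a1 : Commute x₁ u := h11.inv_right
  have a2 : Commute x₁ w := h12.inv_right
  have a3 : Commute x₂ u := h21.inv_right
  have a4 : Commute x₂ w := h22.inv_right
  have a5 : Commute u w := hz.inv_inv
  have b1 : (u * x₁) * (w * x₂) = (x₁ * x₂) * (u * w) := by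
    rw [a1.symm.eq, mul_assoc, ← mul_assoc u w, ← ((a3.mul_right a4)).eq, mul_assoc]
  have b2 : (w * x₂) * (u * x₁) = (x₂ * x₁) * (u * w) := by
    rw [a4.symm.eq, mul_assoc, ← mul_assoc w u, ← a5.eq, ← ((a1.mul_right a2)).eq, mul_assoc]
  have key : y * ⁅x₁, x₂⁆ * y⁻¹ = ⁅x₁, x₂⁆ := by
    calc y * ⁅x₁, x₂⁆ * y⁻¹ = ((y * x₁ * y⁻¹) * (y * x₂ * y⁻¹)) *
          ((y * x₂ * y⁻¹) * (y * x₁ * y⁻¹))⁻¹ := by rw [commutatorElement_def]; group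
      _ = ⁅x₁, x₂⁆ := by rw [e1, e2, b1, b2, commutatorElement_def]; group
  rw [mul_inv_eq_iff_eq_mul] at key
  exact key.symm

/-! ### Commutators supported in boxes of the torus -/

section Simplicity

variable {lam : ℝ}

/-- The inclusion of the lift of Thompson's group into `GLambda lam`. -/
noncomputable def stdEmb (lam : ℝ) : thompsonGroup →* GLambda lam :=
  Subgroup.inclusion fun _ hf => Subgroup.subset_closure (Or.inl hf)

/-- The embedding into `GLambda lam` by conjugation with the homothety of ratio `lam`. -/
noncomputable def scaledEmb (hl : lam ≠ 0) : thompsonGroup →* GLambda lam :=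
  ((MulAut.conj (Homeomorph.mulLeft₀ lam hl)).toMonoidHom.comp thompsonGroup.subtype).codRestrict
    (GLambda lam) fun g => Subgroup.subset_closure <| Or.inr ⟨g, g.2, fun x => by
      show (Homeomorph.mulLeft₀ lam hl * (g : ℝ ≃ₜ ℝ) * (Homeomorph.mulLeft₀ lam hl)⁻¹) (lam * x) = _
      rw [Homeomorph.mul_apply, Homeomorph.mul_apply]
      have : (Homeomorph.mulLeft₀ lam hl)⁻¹ (lam * x) = x := homeo_inv_apply_self _ x
      rw [this]
      rfl⟩

theorem scaledEmb_apply (hl : lam ≠ 0) (g : thompsonGroup) (t : ℝ) :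
    (scaledEmb hl g : ℝ ≃ₜ ℝ) t = lam * (g : ℝ ≃ₜ ℝ) (t / lam) := by
  have : (Homeomorph.mulLeft₀ lam hl)⁻¹ t = t / lam := by
    apply (Homeomorph.mulLeft₀ lam hl).injective
    rw [homeo_apply_inv_self]
    exact (mul_div_cancel₀ t hl).symm
  show lam * (g : ℝ ≃ₜ ℝ) ((Homeomorph.mulLeft₀ lam hl)⁻¹ t) = _
  rw [this]

theorem eq_top_of_stdEmb_mem_of_scaledEmb_mem (hl : lam ≠ 0) {H : Subgroup (GLambda lam)}
    (h1 : ∀ g, stdEmb lam g ∈ H) (h2 : ∀ g, scaledEmb hl g ∈ H) : H = ⊤ := by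
  have hle : GLambda lam ≤ H.map (GLambda lam).subtype := by
    conv_lhs => rw [GLambda]
    rw [Subgroup.closure_le]
    rintro f (hf | ⟨g, hg, hfg⟩)
    · exact ⟨stdEmb lam ⟨f, hf⟩, h1 _, rfl⟩
    · refine ⟨scaledEmb hl ⟨g, hg⟩, h2 _, ?_⟩
      ext t
      show (scaledEmb hl ⟨g, hg⟩ : ℝ ≃ₜ ℝ) t = f t
      rw [scaledEmb_apply]
      conv_rhs => rw [← mul_div_cancel₀ t hl, hfg]
  refine (Subgroup.eq_top_iff' H).2 fun g => ?_
  obtain ⟨x, hx, hxg⟩ := hle g.2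
  rwa [← Subtype.ext hxg]

/-- The points of the line that lie in a small box around the point `(t₀ / lam, t₀)` of the torus,
when the line is wrapped around the torus with slope `lam`. -/
def InBox (lam t₀ r t : ℝ) : Prop := Near t₀ r t ∧ Near (t₀ / lam) r (t / lam)

/-- Elements supported in a common box have commuting images under `q`. -/
def BoxCommutes {Q : Type*} [Group Q] (q : GLambda lam →* Q) (t₀ r : ℝ) : Prop :=
  ∀ u v : GLambda lam, (∀ t, ¬ InBox lam t₀ r t → (u : ℝ ≃ₜ ℝ) t = t) →
    (∀ t, ¬ InBox lam t₀ r t → (v : ℝ ≃ₜ ℝ) t = t) → Commute (q u) (q v)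

/-- A nontrivial element `n` moves a small box of the torus off itself. If `n` is in the kernel of
`q`, an element `u` supported in this box has the same image as its conjugate by `n`, which
commutes with the elements supported in the box. -/
theorem exists_boxCommutes {Q : Type*} [Group Q] (hirr : Irrational lam) (hl : lam ≠ 0)
    (q : GLambda lam →* Q) {n : GLambda lam} (hn : n ≠ 1) (hq : q n = 1) :
    ∃ t₀ r, 0 < r ∧ r ≤ 1 ∧ BoxCommutes q t₀ r := by
  obtain ⟨t₀, ht₀⟩ : ∃ t₀, (n : ℝ ≃ₜ ℝ) t₀ ≠ t₀ := by
    by_contra hc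
    push Not at hc
    exact hn (Subtype.ext (Homeomorph.ext hc))
  set F := planeAction hirr hl n with hF
  have hFt : ∀ t, (F : (ℝ × ℝ) ≃ₜ (ℝ × ℝ)) (t / lam, t) =
      ((n : ℝ ≃ₜ ℝ) t / lam, (n : ℝ ≃ₜ ℝ) t) := by
    intro t
    rw [leafRestrict_apply hl, hF, leafRestrict_planeAction]
  have hne : torusHom F (torusProj (t₀ / lam, t₀)) ≠ torusProj (t₀ / lam, t₀) := by
    intro h
    have h1 : torusHom F (torusProj (t₀ / lam, t₀)) =
      torusProj ((n : ℝ ≃ₜ ℝ) t₀ / lam, (n : ℝ ≃ₜ ℝ) t₀) := by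
      rw [← hFt]; exact leafTorusMap_torusProj F _
    rw [h1, eq_comm, torusProj_eq_iff] at h
    obtain ⟨k, l, hkl⟩ := h
    rw [Prod.ext_iff] at hkl
    obtain ⟨e1, e2⟩ := hkl
    simp only [Prod.fst_add, Prod.snd_add] at e1 e2
    rw [e2, add_div, add_right_inj, div_eq_iff hl] at e1
    by_cases hk : k = 0
    · subst hk
      rw [Int.cast_zero, zero_mul] at e1
      rw [e1, add_zero] at e2
      exact ht₀ e2
    · have hk' : (k : ℝ) ≠ 0 := by exact_mod_cast hk
      refine hirr ⟨(l : ℚ) / k, ?_⟩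
      push_cast
      rw [div_eq_iff hk', e1, mul_comm]
  obtain ⟨U, V, hU, hV, hxU, hxV, hUV⟩ := t2_separation hne
  have hO : IsOpen (torusProj ⁻¹' (V ∩ torusHom F ⁻¹' U)) :=
    (hV.inter (hU.preimage (torusHom F).continuous)).preimage isQuotientMap_torusProj.continuous
  obtain ⟨r, hr, hball⟩ := Metric.isOpen_iff.1 hO (t₀ / lam, t₀) ⟨hxV, hxU⟩
  have hbox : ∀ t, InBox lam t₀ (min r 1) t → torusProj (t / lam, t) ∈ V ∩ torusHom F ⁻¹' U := by
    rintro t ⟨⟨k, hk⟩, l, hl'⟩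
    have : torusProj (t / lam, t) = torusProj ((t / lam, t) + (((-l : ℤ) : ℝ), ((-k : ℤ) : ℝ))) :=
      torusProj_eq_iff.2 ⟨-l, -k, rfl⟩
    rw [this]
    apply hball
    rw [Metric.mem_ball, Prod.dist_eq, max_lt_iff, Real.dist_eq, Real.dist_eq]
    constructor
    · refine lt_of_eq_of_lt (congrArg abs ?_) (hl'.trans_le (min_le_left _ _))
      simp only [Prod.fst_add]; push_cast; ring
    · refine lt_of_eq_of_lt (congrArg abs ?_) (hk.trans_le (min_le_left _ _))
      simp only [Prod.snd_add]; push_cast; ring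
  have hmove : ∀ t, InBox lam t₀ (min r 1) t → ¬ InBox lam t₀ (min r 1) ((n : ℝ ≃ₜ ℝ) t) := by
    intro t ht ht'
    have h1 : torusHom F (torusProj (t / lam, t)) ∈ U := (hbox t ht).2
    have h2 := (hbox _ ht').1
    rw [← hFt, ← leafTorusMap_torusProj] at h2
    exact disjoint_left.1 hUV h1 h2
  refine ⟨t₀, min r 1, lt_min hr one_pos, min_le_right _ _, fun u v hu hv => ?_⟩
  have hc : Commute (n * u * n⁻¹) v := by
    refine Subtype.ext (commute_of_disjoint fun t => ?_).eq
    by_cases ht : InBox lam t₀ (min r 1) t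
    · left
      have : ¬ InBox lam t₀ (min r 1) ((n : ℝ ≃ₜ ℝ)⁻¹ t) := fun h => by
        have := hmove _ h
        rw [homeo_apply_inv_self] at this
        exact this ht
      show (n : ℝ ≃ₜ ℝ) ((u : ℝ ≃ₜ ℝ) ((n : ℝ ≃ₜ ℝ)⁻¹ t)) = t
      rw [hu _ this, homeo_apply_inv_self]
    · exact Or.inr (hv t ht)
  have := hc.map q
  rwa [map_mul, map_mul, map_inv, hq, one_mul, inv_one, mul_one] at this

/-- Conjugation by an integer translation of the line moves the box to another place. -/
theorem BoxCommutes.add_int {Q : Type*} [Group Q] {q : GLambda lam →* Q} {t₀ r : ℝ}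
    (h : BoxCommutes q t₀ r) (n : ℤ) : BoxCommutes q (t₀ + n) r := by
  intro u v hu hv
  let τ : GLambda lam := stdEmb lam ⟨Homeomorph.addRight (n : ℝ), shift_mem (isDyadic_int n)⟩
  have key : ∀ w : GLambda lam, (∀ t, ¬ InBox lam (t₀ + n) r t → (w : ℝ ≃ₜ ℝ) t = t) →
      ∀ t, ¬ InBox lam t₀ r t → ((τ⁻¹ * w * τ : GLambda lam) : ℝ ≃ₜ ℝ) t = t := by
    intro w hw t ht
    have e : ¬ InBox lam (t₀ + n) r (t + n) := by
      rintro ⟨⟨k, hk⟩, l, hl⟩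
      refine ht ⟨⟨k, ?_⟩, l, ?_⟩
      · rwa [show t + n - (t₀ + n) - k = t - t₀ - k by ring] at hk
      · rwa [show (t + n) / lam - (t₀ + n) / lam - l = t / lam - t₀ / lam - l by ring] at hl
    show (τ : ℝ ≃ₜ ℝ)⁻¹ ((w : ℝ ≃ₜ ℝ) (t + n)) = t
    rw [hw _ e]
    exact homeo_inv_apply_self (τ : ℝ ≃ₜ ℝ) t
  have := h _ _ (key u hu) (key v hv)
  simp only [map_mul, map_inv] at this
  have h2 := (Commute.conj_iff (q τ)).2 this
  simpa [mul_assoc] using h2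

/-- If `f` is supported in a horizontal and `g` in a vertical strip of the torus, then `⁅f, g⁆` is
supported in a box around their intersection, enlarged by the displacements of `f` and `g`. -/
theorem commutator_inBox {t₀ δ ε : ℝ} (hlam : 0 < lam) {f g : ℝ ≃ₜ ℝ}
    (hf : ∀ t, ¬ Near t₀ δ t → f t = t) (hg : ∀ t, ¬ Near (t₀ / lam) ε (t / lam) → g t = t)
    (hf' : ∀ t, |f⁻¹ t - t| ≤ 2 * δ) (hg' : ∀ t, |g⁻¹ t - t| ≤ lam * (2 * ε)) (t : ℝ)
    (ht : ¬ (Near t₀ (δ + lam * (2 * ε)) t ∧ Near (t₀ / lam) (ε + 2 * δ / lam) (t / lam))) :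
    f (g (f⁻¹ (g⁻¹ t))) = t := by
  have hδ : 0 ≤ 2 * δ := (abs_nonneg _).trans (hf' 0)
  have hε : 0 ≤ lam * (2 * ε) := (abs_nonneg _).trans (hg' 0)
  rw [not_and_or] at ht
  rcases ht with ht | ht
  · have h1 : ¬ Near t₀ δ (g⁻¹ t) := fun h => ht (h.of_abs_sub_le (hg' t))
    rw [homeo_inv_fix (hf _ h1), homeo_apply_inv_self]
    exact hf t fun h => ht (h.mono (by linarith))
  · have h0 : 0 ≤ 2 * δ / lam := by positivity
    have h1 : ¬ Near (t₀ / lam) ε (t / lam) := fun h => ht (h.mono (by linarith))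
    have h2 : ¬ Near (t₀ / lam) ε (f⁻¹ t / lam) := fun h => ht (h.of_abs_sub_le (by
      rw [← sub_div, abs_div, abs_of_pos hlam]
      gcongr
      exact hf' t))
    rw [homeo_inv_fix (hg t h1), hg _ h2, homeo_apply_inv_self]

theorem scaledEmb_fix (hl : lam ≠ 0) {c ρ : ℝ} {b : thompsonGroup} (hb : b ∈ localGroup c ρ) (t : ℝ)
    (ht : ¬ Near c ρ (t / lam)) : (scaledEmb hl b : ℝ ≃ₜ ℝ) t = t := by
  rw [scaledEmb_apply, hb _ ht, mul_div_cancel₀ t hl]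

theorem scaledEmb_displacement (hlam : 0 < lam) {c ρ : ℝ} (hρ : ρ ≤ 1 / 2) (hρ0 : 0 ≤ ρ)
    {b : thompsonGroup} (hb : b ∈ localGroup c ρ) (t : ℝ) :
    |(scaledEmb hlam.ne' b : ℝ ≃ₜ ℝ) t - t| ≤ lam * (2 * ρ) := by
  have h := abs_apply_sub_le hρ hb (t / lam) hρ0
  rw [scaledEmb_apply]
  conv_lhs => rw [← mul_div_cancel₀ t hlam.ne', mul_div_assoc, ← mul_sub, abs_mul, abs_of_pos hlam]
  rw [mul_div_cancel₀ _ hlam.ne'] at *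
  gcongr

theorem commutator_emb_inBox {t₀ δ ε : ℝ} (hlam : 0 < lam) (hδ : δ ≤ 1 / 2) (hδ0 : 0 ≤ δ)
    (hε : ε ≤ 1 / 2) (hε0 : 0 ≤ ε)
    {a b : thompsonGroup} (ha : a ∈ localGroup t₀ δ) (hb : b ∈ localGroup (t₀ / lam) ε) (t : ℝ)
    (ht : ¬ (Near t₀ (δ + lam * (2 * ε)) t ∧ Near (t₀ / lam) (ε + 2 * δ / lam) (t / lam))) :
    ((⁅stdEmb lam a, scaledEmb hlam.ne' b⁆ : GLambda lam) : ℝ ≃ₜ ℝ) t = t := by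
  refine commutator_inBox (f := (stdEmb lam a : ℝ ≃ₜ ℝ)) (g := (scaledEmb hlam.ne' b : ℝ ≃ₜ ℝ))
    hlam ha (scaledEmb_fix hlam.ne' hb) (fun t => ?_) (fun t => ?_) t ht
  · exact abs_apply_sub_le hδ (inv_mem ha) t hδ0
  · have := scaledEmb_displacement hlam hε hε0 (inv_mem hb) t
    rwa [map_inv] at this

end Simplicity

/-! ### Simplicity and finite generation -/

section Simplicity

variable {lam : ℝ}

/-- Near any given point of the circle some element of Thompson's group is a translation. -/
theorem exists_local_translation (c : ℝ) {m : ℕ} {s : ℝ} (hs : s = (2 ^ m : ℝ)⁻¹) :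
    ∃ b ∈ localGroup c s, ∀ t, Near c (s / 16) t → (b⁻¹ : thompsonGroup).1 t = t - s / 4 := by
  have hs0 : 0 < s := by rw [hs]; positivity
  obtain ⟨a, ha, hac⟩ := exists_isDyadic_near (c - 5 * s / 8) (show 0 < s / 16 by linarith)
  have hlen : (⟨a, m⟩ : DyArc).len = s := hs.symm
  have hac' := abs_lt.1 hac
  refine ⟨(rotT ⟨a, m⟩ ha)⁻¹, inv_mem fun t ht => ?_, fun t ht => ?_⟩
  · refine rot_out' _ fun k => ?_
    rintro ⟨h0, h1⟩
    rw [hlen] at h1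
    simp only at h0 h1
    refine ht ⟨-k, ?_⟩
    rw [abs_lt]
    push_cast
    constructor <;> linarith
  · obtain ⟨k, hk⟩ := ht
    rw [inv_inv]
    rw [abs_lt] at hk
    have h1 := rot_mid ⟨a, m⟩ (x := t - k) (by rw [hlen]; simp only; linarith)
      (by rw [hlen]; simp only; linarith)
    have h2 := rot_add_int ⟨a, m⟩ (t - k) k
    rw [sub_add_cancel, h1, hlen] at h2
    show rot ⟨a, m⟩ t = _
    rw [h2]; ring

variable {Q : Type*} [Group Q] {q : GLambda lam →* Q}

/-- With `b'` a translation near `t₀ / lam` that moves the support of `⁅a, b⁆` off the strip of `a'`, the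
element `a'` agrees on the support of `⁅a, b⁆` with the commutator `⁅a', b'⁆`, which is supported in the
box. -/
theorem commute_commutator_of_box (hlam : 1 < lam) {t₀ r s : ℝ} (hbox : BoxCommutes q t₀ r)
    (hr : r ≤ 1) {m : ℕ} (hs : s = (2 ^ m : ℝ)⁻¹) (hsr : 3 * (lam * s) < r)
    {a a' b : thompsonGroup} (ha : a ∈ localGroup t₀ (lam * s / 64))
    (ha' : a' ∈ localGroup t₀ (lam * s / 64)) (hb : b ∈ localGroup (t₀ / lam) (s / 64)) :
    Commute (q (stdEmb lam a'))
      ⁅q (stdEmb lam a), q (scaledEmb (zero_lt_one.trans hlam).ne' b)⁆ := by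
  have hl0 : 0 < lam := zero_lt_one.trans hlam
  have hs0 : 0 < s := by rw [hs]; positivity
  have hls : s < lam * s := by nlinarith
  have hdiv : 2 * (lam * s / 64) / lam = s / 32 := by field_simp; ring
  obtain ⟨b', hb', htr⟩ := exists_local_translation (t₀ / lam) hs
  set f := stdEmb lam a' with hf
  set h := scaledEmb hl0.ne' b' with hh
  set c := ⁅stdEmb lam a, scaledEmb hl0.ne' b⁆ with hc
  have hcs := commutator_emb_inBox hl0 (by linarith) (by linarith) (by linarith) (by linarith) ha hb
  have hes := commutator_emb_inBox hl0 (by linarith) (by linarith) (by linarith) hs0.le ha' hb'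
  rw [hdiv] at hcs hes
  have c1 : Commute (q ⁅f, h⁆) (q c) := by
    refine hbox _ _ (fun t ht => hes t fun h1 => ht ⟨h1.1.mono ?_, h1.2.mono ?_⟩)
      (fun t ht => hcs t fun h1 => ht ⟨h1.1.mono ?_, h1.2.mono ?_⟩) <;> linarith
  have c2 : Commute (h * f⁻¹ * h⁻¹) c := by
    refine Subtype.ext (commute_of_disjoint fun t => ?_).eq
    by_cases ht : Near t₀ (lam * s / 64 + lam * (2 * (s / 64))) t ∧
        Near (t₀ / lam) (s / 64 + s / 32) (t / lam)
    · left
      have e1 : (h : ℝ ≃ₜ ℝ)⁻¹ t = t - lam * s / 4 := by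
        have : ((h⁻¹ : GLambda lam) : ℝ ≃ₜ ℝ) t = t - lam * (s / 4) := by
          rw [hh, ← map_inv, scaledEmb_apply, htr _ (ht.2.mono (by linarith)), mul_sub,
            mul_div_cancel₀ t hl0.ne']
        rw [← mul_div_assoc] at this
        exact this
      have e2 : ¬ Near t₀ (lam * s / 64) (t - lam * s / 4) :=
        ht.1.not_sub (by linarith) (by linarith)
      show (h : ℝ ≃ₜ ℝ) ((f : ℝ ≃ₜ ℝ)⁻¹ ((h : ℝ ≃ₜ ℝ)⁻¹ t)) = t
      rw [e1, homeo_inv_fix (f := (f : ℝ ≃ₜ ℝ)) (ha' _ e2), ← e1, homeo_apply_inv_self]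
    · exact Or.inr (hcs t ht)
  -- `f` is the product of `⁅f, h⁆`, supported in the box, and an element disjoint from `c`
  have e : f = ⁅f, h⁆ * (h * f⁻¹ * h⁻¹)⁻¹ := by rw [commutatorElement_def]; group
  have : Commute (q f) (q c) := by
    rw [e, map_mul, map_inv]
    exact c1.mul_left (c2.map q).inv_left
  rwa [hc, map_commutatorElement] at this

/-- Each of `a`, `a'` commutes modulo the kernel with both `⁅a, b⁆` and `⁅a', b⁆`, so `⁅a, a'⁆` commutes
with `b`. -/
theorem commute_local_commutator (hlam : 1 < lam) {t₀ r s : ℝ} (hbox : BoxCommutes q t₀ r)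
    (hr : r ≤ 1) {m : ℕ} (hs : s = (2 ^ m : ℝ)⁻¹) (hsr : 3 * (lam * s) < r)
    {a a' b : thompsonGroup} (ha : a ∈ localGroup t₀ (lam * s / 64))
    (ha' : a' ∈ localGroup t₀ (lam * s / 64)) (hb : b ∈ localGroup (t₀ / lam) (s / 64)) :
    Commute (q (stdEmb lam ⁅a, a'⁆)) (q (scaledEmb (zero_lt_one.trans hlam).ne' b)) := by
  have hl0 : 0 < lam := zero_lt_one.trans hlam
  have hs0 : 0 < s := by rw [hs]; positivity
  have hls : s < lam * s := by nlinarith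
  have hdiv : 2 * (lam * s / 64) / lam = s / 32 := by field_simp; ring
  rw [map_commutatorElement, map_commutatorElement]
  refine commute_commutatorElement (commute_commutator_of_box hlam hbox hr hs hsr ha ha hb)
    (commute_commutator_of_box hlam hbox hr hs hsr ha' ha hb)
    (commute_commutator_of_box hlam hbox hr hs hsr ha ha' hb)
    (commute_commutator_of_box hlam hbox hr hs hsr ha' ha' hb) ?_
  rw [← map_commutatorElement, ← map_commutatorElement]
  have h1 := commutator_emb_inBox hl0 (by linarith) (by linarith) (by linarith) (by linarith) ha hb
  have h2 := commutator_emb_inBox hl0 (by linarith) (by linarith) (by linarith) (by linarith) ha' hb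
  rw [hdiv] at h1 h2
  refine hbox _ _ (fun t ht => h1 t fun h => ht ⟨h.1.mono ?_, h.2.mono ?_⟩)
    (fun t ht => h2 t fun h => ht ⟨h.1.mono ?_, h.2.mono ?_⟩) <;> linarith

/-- The boxes around `((t₀ + n) / lam, t₀)` with `n` an integer cover a whole horizontal strip of the
torus, so the previous lemma holds for all elements of the rescaled Thompson group. -/
theorem commute_commutator_scaledEmb (hirr : Irrational lam) (hlam : 1 < lam) {t₀ r s : ℝ}
    (hbox : BoxCommutes q t₀ r) (hr : r ≤ 1) {m : ℕ} (hs : s = (2 ^ m : ℝ)⁻¹)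
    (hsr : 3 * (lam * s) < r) {x : localGroup t₀ (lam * s / 64)}
    (hx : x ∈ commutator (localGroup t₀ (lam * s / 64))) (b : thompsonGroup) :
    Commute (q (stdEmb lam x)) (q (scaledEmb (zero_lt_one.trans hlam).ne' b)) := by
  have hs0 : 0 < s := by rw [hs]; positivity
  set β := scaledEmb (zero_lt_one.trans hlam).ne' with hβ
  have key : ∀ a ∈ localGroup t₀ (lam * s / 64), ∀ a' ∈ localGroup t₀ (lam * s / 64),
      ∀ b : thompsonGroup, Commute (q (stdEmb lam ⁅a, a'⁆)) (q (β b)) := by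
    intro a ha a' ha' b
    let S : Subgroup thompsonGroup :=
      (Subgroup.centralizer {q (stdEmb lam ⁅a, a'⁆)}).comap (q.comp β)
    have hS : ∀ b, b ∈ S ↔ Commute (q (stdEmb lam ⁅a, a'⁆)) (q (β b)) := by
      intro b
      rw [Subgroup.mem_comap, Subgroup.mem_centralizer_singleton_iff]
      exact ⟨fun h => h.symm, fun h => h.symm⟩
    rw [← hS]
    obtain ⟨M, -, hM⟩ := exists_len_lt (show 0 < s / 128 by linarith)
    -- short intervals fit next to a point `(t₀ + n) / lam + k`, where the box around `t₀ + n` can be used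
    suffices S = ⊤ by rw [this]; trivial
    refine eq_top_of_rot_mem M fun D hD hDM => ?_
    have hDlen : D.len < s / 128 := hM _ hDM
    obtain ⟨k, n, hkn⟩ := exists_int_add_int_div_near hirr (D.left - t₀ / lam)
      (show 0 < s / 128 by linarith)
    rw [hS]
    refine commute_local_commutator hlam (hbox.add_int n) hr hs hsr ?_ ?_ ?_
    · rwa [localGroup_add_int]
    · rwa [localGroup_add_int]
    · rw [← localGroup_add_int _ _ k]
      refine rotT_mem_localGroup_self hD ?_
      rw [abs_sub_comm] at hkn
      rw [show D.left - ((t₀ + n) / lam + k) = D.left - t₀ / lam - (k + n / lam) by ring]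
      linarith
  let C : Subgroup (localGroup t₀ (lam * s / 64)) := (Subgroup.centralizer {q (β b)}).comap
    (q.comp ((stdEmb lam).comp (Subgroup.subtype _)))
  have hC : commutator (localGroup t₀ (lam * s / 64)) ≤ C := by
    rw [commutator_def, Subgroup.commutator_le]
    intro a _ a' _
    rw [Subgroup.mem_comap, Subgroup.mem_centralizer_singleton_iff]
    exact key a a.2 a' a'.2 b
  have := hC hx
  rw [Subgroup.mem_comap, Subgroup.mem_centralizer_singleton_iff] at this
  exact this

/-- Translation by `lam * s` belongs to the rescaled Thompson group and moves the support of the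
elements of `localGroup t₀ (lam * s / 64)` off itself. -/
theorem commute_commutator_local (hirr : Irrational lam) (hlam : 1 < lam) {t₀ r s : ℝ}
    (hbox : BoxCommutes q t₀ r) (hr : r ≤ 1) {m : ℕ} (hs : s = (2 ^ m : ℝ)⁻¹)
    (hsr : 3 * (lam * s) < r) {x : localGroup t₀ (lam * s / 64)}
    (hx : x ∈ commutator (localGroup t₀ (lam * s / 64))) (a : localGroup t₀ (lam * s / 64)) :
    Commute (q (stdEmb lam x)) (q (stdEmb lam a)) := by
  have hl0 : 0 < lam := zero_lt_one.trans hlam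
  have hs0 : 0 < s := by rw [hs]; positivity
  have hls : 0 < lam * s := by positivity
  let σ : thompsonGroup := ⟨Homeomorph.addRight s, shift_mem (by rw [hs]; exact isDyadic_inv_two_pow m)⟩
  set τ := scaledEmb hl0.ne' σ with hτ
  have hc := commute_commutator_scaledEmb hirr hlam hbox hr hs hsr hx σ
  have hτi : ∀ t, (τ : ℝ ≃ₜ ℝ)⁻¹ t = t - lam * s := by
    intro t
    apply (τ : ℝ ≃ₜ ℝ).injective
    rw [homeo_apply_inv_self, hτ, scaledEmb_apply]
    show t = lam * ((t - lam * s) / lam + s)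
    field_simp
    ring
  have hd : Commute (τ * stdEmb lam x * τ⁻¹) (stdEmb lam a) := by
    refine Subtype.ext (commute_of_disjoint fun t => ?_).eq
    by_cases ht : Near t₀ (lam * s / 64) t
    · left
      have : ¬ Near t₀ (lam * s / 64) (t - lam * s) := ht.not_sub (by linarith) (by linarith)
      show (τ : ℝ ≃ₜ ℝ) ((x : thompsonGroup).1 ((τ : ℝ ≃ₜ ℝ)⁻¹ t)) = t
      rw [hτi, x.2 _ this, ← hτi, homeo_apply_inv_self]
    · exact Or.inr (a.2 t ht)
  have := hd.map q
  rwa [map_mul, map_mul, map_inv, ← hc.eq, mul_inv_cancel_right] at this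

/-- A homomorphism with nontrivial kernel is trivial on the standard copy of Thompson's group. -/
theorem stdEmb_trivial (hirr : Irrational lam) (hlam : 1 < lam) {n : GLambda lam} (hn : n ≠ 1)
    (hq : q n = 1) (g : thompsonGroup) : q (stdEmb lam g) = 1 := by
  have hl0 : 0 < lam := zero_lt_one.trans hlam
  obtain ⟨t₀, r, hr0, hr1, hbox⟩ := exists_boxCommutes hirr hl0.ne' q hn hq
  obtain ⟨m, -, hm⟩ := exists_len_lt (show 0 < r / (3 * lam) by positivity)
  obtain ⟨s, hs⟩ : ∃ s : ℝ, s = (2 ^ m : ℝ)⁻¹ := ⟨_, rfl⟩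
  have hs0 : 0 < s := by rw [hs]; positivity
  have hsr : 3 * (lam * s) < r := by
    have := hm m le_rfl
    rw [← hs, lt_div_iff₀ (by positivity)] at this
    linarith
  set δ := lam * s / 64 with hδ
  have hδ0 : 0 < δ := by positivity
  -- an interval `E` inside `(t₀ - δ, t₀ + δ)`
  obtain ⟨M, hM1, hM⟩ := exists_len_lt (half_pos hδ0)
  obtain ⟨e, he, het⟩ := exists_isDyadic_near t₀ (half_pos hδ0)
  let E : DyArc := ⟨e, M⟩
  have hElen : E.len < δ / 2 := hM M le_rfl
  have hA : ∀ w, rotT (E.sub w) (E.isDyadic_sub he w) ∈ localGroup t₀ δ := fun w =>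
    rotT_mem_localGroup he (by
      have : |E.left - t₀| < δ / 2 := het
      linarith) w
  let φ : localGroup t₀ δ →* Q := q.comp ((stdEmb lam).comp (Subgroup.subtype _))
  obtain ⟨k1, k2⟩ := rotIn_mem_commutator he hA
  have hone : φ (rotIn he hA [false, true, false, true]) = 1 :=
    map_rotIn_eq_one φ he hA [false, true]
      (commute_commutator_local hirr hlam hbox hr1 hs hsr k1 _)
      fun _ => commute_commutator_local hirr hlam hbox hr1 hs hsr k2 _
  have htop : (q.comp (stdEmb lam)).ker = ⊤ :=
    eq_top_of_normal (E.isDyadic_sub he [false, true, false, true])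
      (hM1.trans (E.level_le_sub _)) hone
  have : g ∈ (q.comp (stdEmb lam)).ker := by rw [htop]; trivial
  exact this

/-- Once the translation by `1` is trivial, elements of the rescaled Thompson group with support in a
short interval have commuting images. -/
theorem scaledEmb_trivial (hlam : 1 < lam) (hq : ∀ g, q (stdEmb lam g) = 1) (g : thompsonGroup) :
    q (scaledEmb (zero_lt_one.trans hlam).ne' g) = 1 := by
  have hl0 : 0 < lam := zero_lt_one.trans hlam
  have hl1 : 1 / lam < 1 := by rw [div_lt_one hl0]; exact hlam
  set β := scaledEmb hl0.ne' with hβ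
  obtain ⟨ρ, hρ0, hρ1, hρ2⟩ : ∃ ρ : ℝ, 0 < ρ ∧ ρ + ρ ≤ 1 / lam ∧ 1 / lam + ρ + ρ ≤ 1 := by
    refine ⟨min (1 / lam) (1 - 1 / lam) / 2, ?_, ?_, ?_⟩
    · exact half_pos (lt_min (by positivity) (by linarith))
    · linarith [min_le_left (1 / lam) (1 - 1 / lam)]
    · linarith [min_le_right (1 / lam) (1 - 1 / lam)]
  obtain ⟨M, hM1, hM⟩ := exists_len_lt hρ0
  let E : DyArc := ⟨0, M⟩
  have hE : IsDyadic E.left := isDyadic_zero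
  have hA : ∀ w, rotT (E.sub w) (E.isDyadic_sub hE w) ∈ localGroup 0 ρ := fun w =>
    rotT_mem_localGroup hE (by
      have : E.len < ρ := hM M le_rfl
      simp only [E, sub_self, abs_zero] at *
      linarith) w
  let τ : GLambda lam := stdEmb lam ⟨Homeomorph.addRight 1, shift_mem (by exact_mod_cast isDyadic_int 1)⟩
  have hτ : q τ = 1 := hq _
  have hτi : ∀ t, (τ : ℝ ≃ₜ ℝ)⁻¹ t = t - 1 := fun t => rfl
  have hcomm : ∀ x y : localGroup 0 ρ, Commute (q (β x)) (q (β y)) := by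
    intro x y
    have hd : Commute (τ * β x * τ⁻¹) (β y) := by
      refine Subtype.ext (commute_of_disjoint fun t => ?_).eq
      by_cases ht : Near 0 ρ (t / lam)
      · left
        have : ¬ Near 0 ρ ((t - 1) / lam) := by
          rw [sub_div]; exact ht.not_sub hρ1 hρ2
        show (τ : ℝ ≃ₜ ℝ) ((β x : ℝ ≃ₜ ℝ) ((τ : ℝ ≃ₜ ℝ)⁻¹ t)) = t
        rw [hτi, scaledEmb_fix hl0.ne' x.2 _ this, ← hτi, homeo_apply_inv_self]
      · exact Or.inr (scaledEmb_fix hl0.ne' y.2 _ ht)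
    have := hd.map q
    rwa [map_mul, map_mul, map_inv, hτ, one_mul, inv_one, mul_one] at this
  let φ : localGroup 0 ρ →* Q := q.comp (β.comp (Subgroup.subtype _))
  have hone : φ (rotIn hE hA [false, true]) = 1 :=
    map_rotIn_eq_one φ hE hA [] (hcomm _ _) fun _ => hcomm _ _
  have htop : (q.comp β).ker = ⊤ :=
    eq_top_of_normal (E.isDyadic_sub hE [false, true]) (hM1.trans (E.level_le_sub _)) hone
  have : g ∈ (q.comp β).ker := by rw [htop]; trivial
  exact this

theorem isSimpleGroup_GLambda (hirr : Irrational lam) (hlam : 1 < lam) :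
    IsSimpleGroup (GLambda lam) := by
  have hl0 : 0 < lam := zero_lt_one.trans hlam
  have hnt : Nontrivial (GLambda lam) := by
    refine ⟨stdEmb lam ⟨Homeomorph.addRight 1, shift_mem (by exact_mod_cast isDyadic_int 1)⟩, 1,
      fun h => ?_⟩
    have h1 := congrArg (fun g : GLambda lam => (g : ℝ ≃ₜ ℝ) 0) h
    have h2 : (0 : ℝ) + 1 = 0 := h1
    norm_num at h2
  refine { hnt with eq_bot_or_eq_top_of_normal := fun N hN => ?_ }
  rw [or_iff_not_imp_left]
  intro hbot
  obtain ⟨⟨n, hn⟩, hne⟩ := N.ne_bot_iff_exists_ne_one.1 hbot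
  have hn1 : n ≠ 1 := fun h => hne (Subtype.ext h)
  have hqn : QuotientGroup.mk' N n = 1 := (QuotientGroup.eq_one_iff n).2 hn
  have h1 := stdEmb_trivial (q := QuotientGroup.mk' N) hirr hlam hn1 hqn
  exact eq_top_of_stdEmb_mem_of_scaledEmb_mem hl0.ne'
    (fun g => (QuotientGroup.eq_one_iff _).1 (h1 g))
    fun g => (QuotientGroup.eq_one_iff _).1 (scaledEmb_trivial hlam h1 g)

theorem fg_GLambda (hl : lam ≠ 0) : Group.FG (GLambda lam) := by
  obtain ⟨F, hF, hFc⟩ := exists_finite_closure_eq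
  have hT : Group.FG thompsonGroup := by
    rw [Group.fg_iff_subgroup_fg, Subgroup.fg_iff]
    exact ⟨F, hFc, hF⟩
  obtain ⟨S, hS, hSf⟩ := Group.fg_iff.1 hT
  refine Group.fg_iff.2 ⟨stdEmb lam '' S ∪ scaledEmb hl '' S, ?_, (hSf.image _).union (hSf.image _)⟩
  have key : ∀ (φ : thompsonGroup →* GLambda lam) (g : thompsonGroup),
      φ g ∈ Subgroup.closure (φ '' S) := by
    intro φ g
    rw [← MonoidHom.map_closure, hS]
    exact ⟨g, trivial, rfl⟩
  exact eq_top_of_stdEmb_mem_of_scaledEmb_mem hl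
    (fun g => Subgroup.closure_mono subset_union_left (key _ g))
    fun g => Subgroup.closure_mono subset_union_right (key _ g)

end Simplicity

theorem corollary1p2 (lam : ℝ) (hirr : Irrational lam) (hlam : 1 < lam) :
    Group.FG (GLambda lam) ∧ IsSimpleGroup (GLambda lam) ∧
    ∃ (Φ : GLambda lam →* ((ℝ × ℝ) ≃ₜ (ℝ × ℝ))) (Ψ : GLambda lam →* (Torus ≃ₜ Torus)),
      (∀ (g : GLambda lam) (p : ℝ × ℝ) (m n : ℤ),
        Φ g (p + ((m : ℝ), (n : ℝ))) = Φ g p + ((m : ℝ), (n : ℝ))) ∧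
      (∀ (g : GLambda lam) (c : ℝ), Φ g '' slopeLeaf lam c = slopeLeaf lam c) ∧
      (∀ (g : GLambda lam) (t : ℝ),
        Φ g (t / lam, t) = ((g : ℝ ≃ₜ ℝ) t / lam, (g : ℝ ≃ₜ ℝ) t)) ∧
      (∀ (g : GLambda lam) (p : ℝ × ℝ), Ψ g (torusProj p) = torusProj (Φ g p)) ∧
      IsMinimalAction Ψ := by
  have hl : lam ≠ 0 := (zero_lt_one.trans hlam).ne'
  refine ⟨fg_GLambda hl, isSimpleGroup_GLambda hirr hlam,
    (leafGroup lam).subtype.comp (planeAction hirr hl), torusHom.comp (planeAction hirr hl),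
    fun g => (planeAction hirr hl g).2.1, fun g => leafGroup_image (planeAction hirr hl g).2,
    fun g t => ?_, fun g => leafTorusMap_torusProj _, isMinimalAction_torus hirr hl⟩
  rw [← leafRestrict_planeAction hirr hl g]
  exact leafRestrict_apply hl _ t
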